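/- Let $k$ be an algebraically closed field of characteristic $0$ and let $C$ be a smooth curve over $k$ (a separated $k$-scheme, smooth of relative dimension $1$). All functors are functors on commutative $k$-algebras $R$. Let $\mathrm{Aut}^+O(R)$ be the group (under composition) of continuous $R$-algebra automorphisms $\rho$ of $R[[z]]$ with $\rho(zR[[z]])\subset zR[[z]]$, where $R[[z]]$ has the $z$-adic topology; it is functorial in $R$ by applying $R\to S$ to the coefficients of $\rho(z)$. Let $JC(R)=C(R[[z]])$, with the left action of $\mathrm{Aut}^+O(R)$ through its action on $R[[z]]$ and the projection $JC\to C$, $z\mapsto 0$. Let $\mathrm{Aut}_C(R)\subset JC(R)$ be the set of those $y$ for which the pullback of differentials $$\hat y^*\Omega^1_C=\varprojlim_n \big(y|_{\mathrm{Spec}\,R[z]/z^n}\big)^*\Omega^1_C\;\longrightarrow\;\Omega^{1,\mathrm{cont}}_{R[[z]]/R}=\varprojlim_n\Omega^1_{(R[z]/z^n)/R}$$ is an isomorphism. For an affine open $U=\mathrm{Spec}\,A\subset C$ and $x\in U(R)=\mathrm{Hom}_k(A,R)$ let $J_x$ be the kernel of $A\otimes_k R\to R$, $a\otimes r\mapsto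 x(a)r$, and $\mathcal T_xR=\varprojlim_n (A\otimes_k R)/J_x^n$ with its inverse limit topology. A coordinate on $U$ is a $t\in A$ with $\Omega^1_{A/k}=A\,dt$. (1) $\mathrm{Aut}_C$ is a subfunctor of $JC$ stable under $\mathrm{Aut}^+O$, and the projection $\mathrm{Aut}_C\to C$ exhibits it as a left $\mathrm{Aut}^+O$-torsor over $C$: the projection is $\mathrm{Aut}^+O$-invariant, $\mathrm{Aut}^+O(R)$ acts simply transitively on each non-empty fibre of $\mathrm{Aut}_C(R)\to C(R)$, and $C$ is covered by affine opens $U$ for which there is an $\mathrm{Aut}^+O$-equivariant isomorphism of functors $U\times\mathrm{Aut}^+O\simeq \mathrm{Aut}_C\times_C U$ over $U$. (2) Let $U=\mathrm{Spec}\,A$ be an affine open of $C$ (for instance $U=C$ if $C$ is affine) with a coordinate $t$. For every $R$ and $x\in U(R)$, sending $\varphi$ to the jet given by $A\to A\otimes_k R\to\mathcal T_xR\xrightarrow{\varphi}R[[z]]$ is a bijection from the set of isomorphisms of topological $R$-algebras $\varphi:\mathcal T_xR\to R[[z]]$ with $\varphi(J_x)\subset zR[[z]]$ onto the set of elements of $\mathrm{Aut}_C(R)$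 lying over $x$. Thus $\mathrm{Aut}_C(R)$ is, over $U$, the set of pairs $(x,\varphi)$. (3) In the situation of (2), for each $x\in U(R)$ there is exactly one such isomorphism $\rho^x_t:\mathcal T_xR\to R[[z]]$ with $(\rho^x_t)^{-1}(z)=t-x(t)$, and $\psi_t:U\times\mathrm{Aut}^+O\to\mathrm{Aut}_C\times_CU$, $(x,\rho)\mapsto(x,\rho\circ\rho^x_t)$, is an $\mathrm{Aut}^+O$-equivariant isomorphism of functors over $U$ (a trivialization); it sends $(x,1)$ to $(x,\rho^x_t)$. (4) If $t,s$ are two coordinates on $U=\mathrm{Spec}\,A$ and $\partial_t$ is the $k$-derivation of $A$ with $\partial_t t=1$ (which exists), then there is $u\in\mathrm{Aut}^+O(A)$ with $u(z)=\sum_{n\ge1}\frac1{n!}(\partial_t^n s)z^n$, and $\psi_s^{-1}\psi_t(x,\rho)=(x,\rho\cdot x(u))$ for all $R$, $x\in U(R)$ and $\rho\in\mathrm{Aut}^+O(R)$, where $x(u)\in\mathrm{Aut}^+O(R)$ is the image of $u$ under $x:A\to R$. -/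

import Mathlib

open CategoryTheory AlgebraicGeometry PowerSeries TensorProduct KaehlerDifferential
open scoped Topology

universe u

noncomputable section

namespace CurveJets

/-! ### The group functor `Aut⁺O` -/

section AutPlus

variable (R : Type u) [CommRing R]

/-- The ideal `𝔪_R = z R[[z]]`. -/
abbrev maxIdeal : Ideal R⟦X⟧ := Ideal.span {(X : R⟦X⟧)}

/-- The `z`-adic topology of `R[[z]]`. -/
abbrev zTop : TopologicalSpace R⟦X⟧ := (maxIdeal R).adicTopology

variable {R}

theorem map_mem_pow (σ : R⟦X⟧ →ₐ[R] R⟦X⟧) (h : ∀ g ∈ maxIdeal R, σ g ∈ maxIdeal R) (n : ℕ)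
    {g : R⟦X⟧} (hg : g ∈ maxIdeal R ^ n) : σ g ∈ maxIdeal R ^ n := by
  have h1 : (maxIdeal R ^ n).map σ.toRingHom ≤ maxIdeal R ^ n := by
    rw [Ideal.map_pow]
    refine Ideal.pow_right_mono ?_ n
    rw [Ideal.map_le_iff_le_comap]
    exact fun g hg => h g hg
  exact h1 (Ideal.mem_map_of_mem σ.toRingHom hg)

theorem continuous_of_map_mem (σ : R⟦X⟧ →ₐ[R] R⟦X⟧)
    (h : ∀ g ∈ maxIdeal R, σ g ∈ maxIdeal R) : Continuous[zTop R, zTop R] σ := by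
  let := zTop R
  have : IsTopologicalAddGroup R⟦X⟧ :=
    (maxIdeal R).adic_basis.toRing_subgroups_basis.toRingFilterBasis.isTopologicalAddGroup
  refine continuous_of_continuousAt_zero σ.toRingHom.toAddMonoidHom ?_
  rw [ContinuousAt, map_zero]
  refine ((maxIdeal R).hasBasis_nhds_zero_adic.tendsto_iff
    (maxIdeal R).hasBasis_nhds_zero_adic).2 fun n _ => ⟨n, trivial, fun g hg => ?_⟩
  exact map_mem_pow σ h n hg

/-- An `R`-algebra endomorphism of `R[[z]]` preserving `z R[[z]]` is determined by the image
of `z`. -/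
theorem algHom_ext (σ τ : R⟦X⟧ →ₐ[R] R⟦X⟧) (hσ : ∀ g ∈ maxIdeal R, σ g ∈ maxIdeal R)
    (hτ : ∀ g ∈ maxIdeal R, τ g ∈ maxIdeal R) (h : σ X = τ X) : σ = τ := by
  ext g n
  have hpoly : ∀ q : Polynomial R, σ (q : R⟦X⟧) = τ (q : R⟦X⟧) := by
    intro q
    have : σ.comp (Polynomial.coeToPowerSeries.algHom R) =
        τ.comp (Polynomial.coeToPowerSeries.algHom R) := by
      apply Polynomial.algHom_ext
      simpa using h
    simpa using congrArg (fun f => f q) this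
  have hsub : g - (trunc (n + 1) g : R⟦X⟧) ∈ maxIdeal R ^ (n + 1) := by
    rw [Ideal.span_singleton_pow, Ideal.mem_span_singleton, X_pow_dvd_iff]
    intro m hm
    simp [coeff_trunc, hm]
  have h1 := map_mem_pow σ hσ _ hsub
  have h2 := map_mem_pow τ hτ _ hsub
  have h3 := Ideal.sub_mem _ h1 h2
  rw [map_sub, map_sub, hpoly, sub_sub_sub_cancel_right, Ideal.span_singleton_pow,
    Ideal.mem_span_singleton, X_pow_dvd_iff] at h3
  have := h3 n (Nat.lt_succ_self n)
  rwa [map_sub, sub_eq_zero] at this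

theorem symm_map_mem (ρ : R⟦X⟧ ≃ₐ[R] R⟦X⟧) (h : ∀ g ∈ maxIdeal R, ρ g ∈ maxIdeal R) :
    ∀ g ∈ maxIdeal R, ρ.symm g ∈ maxIdeal R := by
  intro g hg
  have key : ρ.symm g - C (constantCoeff (ρ.symm g)) ∈ maxIdeal R := by
    rw [Ideal.mem_span_singleton, X_dvd_iff]; simp
  have h1 := h _ key
  rw [map_sub, AlgEquiv.apply_symm_apply] at h1
  have h2 : ρ (C (constantCoeff (ρ.symm g))) = C (constantCoeff (ρ.symm g)) :=
    ρ.commutes (constantCoeff (ρ.symm g))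
  have h3 := Ideal.sub_mem _ hg h1
  rw [h2, sub_sub_cancel, Ideal.mem_span_singleton, X_dvd_iff, constantCoeff_C] at h3
  rwa [Ideal.mem_span_singleton, X_dvd_iff]

variable (R) in
/-- `Aut⁺O(R)`: the group of continuous (with continuous inverse) `R`-algebra automorphisms `ρ` of
`R[[z]]` such that `ρ(𝔪_R) ⊆ 𝔪_R`. The group law is composition of automorphisms. -/
def AutPlus : Subgroup (R⟦X⟧ ≃ₐ[R] R⟦X⟧) where
  carrier := {ρ | Continuous[zTop R, zTop R] ρ ∧ Continuous[zTop R, zTop R] ρ.symm ∧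
    ∀ g ∈ maxIdeal R, ρ g ∈ maxIdeal R}
  mul_mem' := fun {a b} ha hb => by
    let := zTop R
    exact ⟨ha.1.comp hb.1, hb.2.1.comp ha.2.1, fun g hg => ha.2.2 _ (hb.2.2 _ hg)⟩
  one_mem' := by
    let := zTop R
    exact ⟨continuous_id, continuous_id, fun g hg => hg⟩
  inv_mem' := fun {a} ha => ⟨ha.2.1, ha.1, symm_map_mem a ha.2.2⟩

variable {S : Type u} [CommRing S]

theorem hasSubst_map (f : R →+* S) (ρ : AutPlus R) :
    HasSubst (PowerSeries.map f (ρ.1 X)) := by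
  apply HasSubst.of_constantCoeff_zero'
  have h := ρ.2.2.2 X (Ideal.mem_span_singleton_self _)
  rw [Ideal.mem_span_singleton, X_dvd_iff] at h
  rw [← coeff_zero_eq_constantCoeff_apply, coeff_map, coeff_zero_eq_constantCoeff_apply, h,
    map_zero]

/-- The `S`-algebra endomorphism `z ↦ f(ρ(z))` of `S[[z]]`. -/
def mapHom (f : R →+* S) (ρ : AutPlus R) : S⟦X⟧ →ₐ[S] S⟦X⟧ :=
  substAlgHom (hasSubst_map f ρ)

theorem mapHom_X (f : R →+* S) (ρ : AutPlus R) :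
    mapHom f ρ X = PowerSeries.map f (ρ.1 X) :=
  substAlgHom_X (hasSubst_map f ρ)

theorem mapHom_mem (f : R →+* S) (ρ : AutPlus R) :
    ∀ g ∈ maxIdeal S, mapHom f ρ g ∈ maxIdeal S := by
  intro g hg
  obtain ⟨a, rfl⟩ := Ideal.mem_span_singleton.1 hg
  rw [map_mul, mapHom_X]
  refine Ideal.mul_mem_right _ _ ?_
  obtain ⟨b, hb⟩ := Ideal.mem_span_singleton.1 (ρ.2.2.2 X (Ideal.mem_span_singleton_self _))
  rw [hb, map_mul, map_X]
  exact Ideal.mul_mem_right _ _ (Ideal.mem_span_singleton_self _)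

theorem eq_subst (ρ : AutPlus R) (g : R⟦X⟧) : ρ.1 g = g.subst (ρ.1 X) := by
  have h := hasSubst_map (RingHom.id R) ρ
  have e : PowerSeries.map (RingHom.id R) (ρ.1 X) = ρ.1 X := by simp
  have := algHom_ext ρ.1.toAlgHom (mapHom (RingHom.id R) ρ) ρ.2.2.2 (mapHom_mem _ ρ)
    (by rw [mapHom_X, e]; rfl)
  have h2 := congrArg (fun σ => σ g) this
  change ρ.1 g = substAlgHom h g at h2
  rw [h2, coe_substAlgHom, e]

theorem mapHom_map (f : R →+* S) (ρ : AutPlus R) (g : R⟦X⟧) :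
    mapHom f ρ (PowerSeries.map f g) = PowerSeries.map f (ρ.1 g) := by
  have h := hasSubst_map (RingHom.id R) ρ
  have e : PowerSeries.map (RingHom.id R) (ρ.1 X) = ρ.1 X := by simp
  rw [e] at h
  rw [eq_subst ρ g, mapHom, coe_substAlgHom]
  exact (map_subst h g).symm

theorem mapHom_mul (f : R →+* S) (ρ τ : AutPlus R) :
    (mapHom f ρ).comp (mapHom f τ) = mapHom f (ρ * τ) := by
  refine algHom_ext _ _ (fun g hg => mapHom_mem f ρ _ (mapHom_mem f τ g hg)) (mapHom_mem _ _) ?_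
  rw [AlgHom.comp_apply, mapHom_X, mapHom_X, mapHom_map]
  rfl

theorem mapHom_one (f : R →+* S) : mapHom f (1 : AutPlus R) = AlgHom.id S S⟦X⟧ := by
  refine algHom_ext _ _ (mapHom_mem _ _) (fun g hg => hg) ?_
  rw [mapHom_X]
  exact map_X f

/-- Functoriality of `Aut⁺O`: for `f : R → S`, the automorphism `ρ` of `R[[z]]` goes to the
automorphism of `S[[z]]` with `z ↦ f(ρ(z))`. -/
def AutPlus.map (f : R →+* S) : AutPlus R →* AutPlus S where
  toFun ρ :=
    ⟨AlgEquiv.ofAlgHom (mapHom f ρ) (mapHom f ρ⁻¹)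
      (by rw [mapHom_mul, mul_inv_cancel, mapHom_one])
      (by rw [mapHom_mul, inv_mul_cancel, mapHom_one]),
      continuous_of_map_mem _ (mapHom_mem f ρ), continuous_of_map_mem _ (mapHom_mem f ρ⁻¹),
      mapHom_mem f ρ⟩
  map_one' := by
    apply Subtype.ext
    ext1 g
    exact congrArg (fun σ => σ g) (mapHom_one f)
  map_mul' ρ τ := by
    apply Subtype.ext
    ext1 g
    exact congrArg (fun σ => σ g) (mapHom_mul f ρ τ).symm

end AutPlus

/-! ### Points, jets and the action of `Aut⁺O` -/

section Points

variable {k : Type u} [Field k] {C : Scheme.{u}} (p : C ⟶ Spec (CommRingCat.of k))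

/-- `C(R)`: the morphisms `Spec R ⟶ C` over `k`, for a `k`-scheme `p : C ⟶ Spec k`. -/
def Pt (R : Type u) [CommRing R] [Algebra k R] : Type u :=
  {x : Spec (CommRingCat.of R) ⟶ C // x ≫ p = Spec.map (CommRingCat.ofHom (algebraMap k R))}

/-- `JC(R) = C(R[[z]])`. -/
abbrev Jet (R : Type u) [CommRing R] [Algebra k R] : Type u := Pt p R⟦X⟧

variable {p} {R S : Type u} [CommRing R] [Algebra k R] [CommRing S] [Algebra k S]

/-- Functoriality of `C(-)`. -/
def Pt.map (f : R →ₐ[k] S) (x : Pt p R) : Pt p S :=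
  ⟨Spec.map (CommRingCat.ofHom f.toRingHom) ≫ x.1, by
    rw [Category.assoc, x.2, ← Spec.map_comp, ← CommRingCat.ofHom_comp]
    exact congrArg (fun g => Spec.map (CommRingCat.ofHom g)) f.comp_algebraMap⟩

/-- Functoriality of `JC(-)`. -/
def Jet.map (f : R →ₐ[k] S) (y : Jet p R) : Jet p S := Pt.map (PowerSeries.mapAlgHom f) y

variable (k R) in
/-- The `k`-algebra map `R[[z]] → R`, `z ↦ 0`. -/
def evalZero : R⟦X⟧ →ₐ[k] R where
  __ := (constantCoeff : R⟦X⟧ →+* R)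
  commutes' c := by
    change constantCoeff (algebraMap k R⟦X⟧ c) = _
    rw [IsScalarTower.algebraMap_apply k R R⟦X⟧]
    exact constantCoeff_C _

/-- The projection `JC → C`. -/
def Jet.base (y : Jet p R) : Pt p R := Pt.map (evalZero k R) y

/-- The left action of `Aut⁺O(R)` on `JC(R) = C(R[[z]])` through the action of `Aut⁺O(R)` on
`R[[z]]`. -/
instance : MulAction (AutPlus R) (Jet p R) where
  smul ρ y := Pt.map (ρ.1.toAlgHom.restrictScalars k) y
  one_smul y := by
    apply Subtype.ext
    change Spec.map (𝟙 _) ≫ y.1 = y.1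
    rw [Spec.map_id, Category.id_comp]
  mul_smul ρ τ y := by
    apply Subtype.ext
    change Spec.map (CommRingCat.ofHom (τ.1.toAlgHom.restrictScalars k).toRingHom ≫
      CommRingCat.ofHom (ρ.1.toAlgHom.restrictScalars k).toRingHom) ≫ y.1 = Spec.map _ ≫ Spec.map _ ≫ y.1
    rw [Spec.map_comp, Category.assoc]

end Points

/-! ### The subfunctor `Aut_C` of `JC` -/

section Differentials

variable (k R A : Type u) [Field k] [CommRing R] [Algebra k R] [CommRing A] [Algebra k A]

/-- `R[z]/zⁿ`, as a quotient of `R[[z]]`. -/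
abbrev TruncPS (n : ℕ) : Type u := R⟦X⟧ ⧸ maxIdeal R ^ n

variable {R} in
/-- For a map of `R`-algebras `B → B'`, the map `Ω¹_{B/R} → Ω¹_{B'/R}`. -/
def omegaMap {B B' : Type u} [CommRing B] [CommRing B'] [Algebra R B] [Algebra R B']
    (f : B →ₐ[R] B') : Ω[B⁄R] →ₗ[R] Ω[B'⁄R] :=
  letI := f.toRingHom.toAlgebra
  haveI : IsScalarTower R B B' := IsScalarTower.of_algebraMap_eq fun r => (f.commutes r).symm
  (KaehlerDifferential.map R R B B').restrictScalars R

/-- `Ω^{1,cont}_{R[[z]]/R} = lim_n Ω¹_{(R[z]/zⁿ)/R}`, as compatible families. -/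
def ContOmega : Type u :=
  {w : ∀ n, Ω[TruncPS R n⁄R] //
    ∀ n, omegaMap (Ideal.Quotient.factorₐ R (Ideal.pow_le_pow_right n.le_succ)) (w (n + 1)) = w n}

variable [Algebra A R⟦X⟧] [IsScalarTower k A R⟦X⟧]

/-- For a `k`-algebra map `A → R[[z]]`, i.e. a jet `x` of `Spec A`, the module
`x̂^*Ω¹_A = lim_n (R[z]/zⁿ ⊗_A Ω¹_{A/k})`, as compatible families. -/
def PullbackOmega : Type u :=
  {w : ∀ n, TruncPS R n ⊗[A] Ω[A⁄k] //
    ∀ n, LinearMap.rTensor Ω[A⁄k]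
      (Ideal.Quotient.factorₐ A (Ideal.pow_le_pow_right n.le_succ)).toLinearMap (w (n + 1)) = w n}

/-- The pullback of differentials `R[z]/zⁿ ⊗_A Ω¹_{A/k} → Ω¹_{(R[z]/zⁿ)/R}`,
`b ⊗ da ↦ b d(x(a))`. -/
def pullbackMapTrunc (n : ℕ) : TruncPS R n ⊗[A] Ω[A⁄k] →ₗ[TruncPS R n] Ω[TruncPS R n⁄R] :=
  haveI : IsScalarTower k A (TruncPS R n) := inferInstance
  haveI : IsScalarTower k R (TruncPS R n) := inferInstance
  (KaehlerDifferential.map k R A (TruncPS R n)).liftBaseChange (TruncPS R n)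

theorem omegaMap_pullbackMapTrunc (n : ℕ) (w : TruncPS R (n + 1) ⊗[A] Ω[A⁄k]) :
    omegaMap (Ideal.Quotient.factorₐ R (Ideal.pow_le_pow_right n.le_succ))
      (pullbackMapTrunc k R A (n + 1) w) =
    pullbackMapTrunc k R A n (LinearMap.rTensor Ω[A⁄k]
      (Ideal.Quotient.factorₐ A (Ideal.pow_le_pow_right n.le_succ)).toLinearMap w) := by
  induction w using TensorProduct.induction_on with
  | zero => simp
  | add a b ha hb => rw [map_add, map_add, ha, hb, map_add, map_add]
  | tmul b ω =>
    have hω : ω ∈ Submodule.span A (Set.range (D k A)) := by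
      rw [KaehlerDifferential.span_range_derivation]; trivial
    induction hω using Submodule.span_induction generalizing b with
    | zero => simp
    | add a c _ _ ha hc =>
      rw [TensorProduct.tmul_add, map_add, map_add, ha, hc, map_add, map_add]
    | smul a c _ hc =>
      rw [← TensorProduct.smul_tmul]
      exact hc _
    | mem c hc =>
      obtain ⟨a, rfl⟩ := hc
      simp only [pullbackMapTrunc, omegaMap, LinearMap.liftBaseChange_tmul,
        KaehlerDifferential.map_D, LinearMap.rTensor_tmul, LinearMap.restrictScalars_apply,
        map_smul]
      rfl

/-- The pullback of differentials `x̂^*Ω¹_A → Ω^{1,cont}_{R[[z]]/R}`. -/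
def pullbackMap (w : PullbackOmega k R A) : ContOmega R :=
  ⟨fun n => pullbackMapTrunc k R A n (w.1 n), fun n => by
    rw [omegaMap_pullbackMapTrunc, w.2 n]⟩

end Differentials

section AutC

/-- For a jet `φ : A → R[[z]]` of `Spec A`, the map `x̂^*Ω¹_A → Ω^{1,cont}_{R[[z]]/R}` is an
isomorphism. -/
def IsIsoOnOmega {k R A : Type u} [Field k] [CommRing R] [Algebra k R] [CommRing A] [Algebra k A]
    (φ : A →ₐ[k] R⟦X⟧) : Prop :=
  letI := φ.toRingHom.toAlgebra
  haveI : IsScalarTower k A R⟦X⟧ := IsScalarTower.of_algebraMap_eq fun c => (φ.commutes c).symm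
  Function.Bijective (pullbackMap k R A)

variable {k : Type u} [Field k] {C : Scheme.{u}} (p : C ⟶ Spec (CommRingCat.of k))

/-- `Aut_C(R)`, the set of those jets `y ∈ JC(R) = C(R[[z]])` for which
`ŷ^*Ω¹_C → Ω^{1,cont}_{R[[z]]/R}` is an isomorphism. For a general `C` this is a map of sheaves on
the formal spectrum of `R[[z]]`, whose underlying space is `Spec R`. It is an isomorphism
iff it is one over each `D(f) ⊆ Spec R` on which `y` factors through an affine open `Spec A` of
`C`; there `y` is given by a map `φ : A → R_f[[z]]`, and the map of sheaves is
`lim_n (R_f[z]/zⁿ ⊗_A Ω¹_{A/k}) → lim_n Ω¹_{(R_f[z]/zⁿ)/R_f}`.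
(An affine open of `C` is given as an `A`-point `j` of `C` which is an open immersion.) -/
def AutC (R : Type u) [CommRing R] [Algebra k R] : Set (Jet p R) :=
  {y | ∀ (A : Type u) [CommRing A] [Algebra k A] (j : Pt p A) [IsOpenImmersion j.1] (f : R)
    (φ : A →ₐ[k] (Localization.Away f)⟦X⟧),
    Jet.map (IsScalarTower.toAlgHom k R (Localization.Away f)) y = Pt.map φ j →
      IsIsoOnOmega φ}

end AutC

/-! ### Torsors -/

section Torsor

variable {k : Type u} [Field k] {C : Scheme.{u}} {p : C ⟶ Spec (CommRingCat.of k)}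

/-- Let `P` be a family of subsets of the sets `JC(R)`, and let `j : Spec A ⟶ C` be an
affine open `U` of `C`. The maps `ψ_R : U(R) × Aut⁺O(R) → JC(R)` (where `U(R) = Hom_k(A, R)`) are
an `Aut⁺O`-equivariant isomorphism of functors `U × Aut⁺O ≃ P ×_C U` over `U`. -/
structure IsTrivialization (P : ∀ (R : Type u) [CommRing R] [Algebra k R], Set (Jet p R))
    {A : Type u} [CommRing A] [Algebra k A] (j : Pt p A)
    (ψ : ∀ (R : Type u) [CommRing R] [Algebra k R], (A →ₐ[k] R) → AutPlus R → Jet p R) : Prop where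
  /-- `ψ_R` is over `U`, and is bijective over each point `x` of `U(R)`. -/
  bijOn : ∀ (R : Type u) [CommRing R] [Algebra k R] (x : A →ₐ[k] R),
    Set.BijOn (ψ R x) Set.univ {y | y ∈ P R ∧ y.base = Pt.map x j}
  equivariant : ∀ (R : Type u) [CommRing R] [Algebra k R] (x : A →ₐ[k] R) (σ ρ : AutPlus R),
    ψ R x (σ * ρ) = σ • ψ R x ρ
  natural : ∀ (R S : Type u) [CommRing R] [Algebra k R] [CommRing S] [Algebra k S]
    (f : R →ₐ[k] S) (x : A →ₐ[k] R) (ρ : AutPlus R),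
    Jet.map f (ψ R x ρ) = ψ S (f.comp x) (AutPlus.map f.toRingHom ρ)

/-- The family `P` of subsets of the sets `JC(R)` is a subfunctor of `JC` stable under the left
action of `Aut⁺O`, and the projection `P → C` makes it a left `Aut⁺O`-torsor over `C`: the
projection is invariant, the action is simply transitive on the fibres of `P(R) → C(R)`,
and `P` is trivial Zariski locally on `C`. -/
structure IsLeftTorsor (P : ∀ (R : Type u) [CommRing R] [Algebra k R], Set (Jet p R)) : Prop where
  map_mem : ∀ (R S : Type u) [CommRing R] [Algebra k R] [CommRing S] [Algebra k S]
    (f : R →ₐ[k] S) (y : Jet p R), y ∈ P R → Jet.map f y ∈ P S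
  smul_mem : ∀ (R : Type u) [CommRing R] [Algebra k R] (ρ : AutPlus R) (y : Jet p R),
    y ∈ P R → ρ • y ∈ P R
  map_smul : ∀ (R S : Type u) [CommRing R] [Algebra k R] [CommRing S] [Algebra k S]
    (f : R →ₐ[k] S) (ρ : AutPlus R) (y : Jet p R), y ∈ P R →
    Jet.map f (ρ • y) = AutPlus.map f.toRingHom ρ • Jet.map f y
  base_smul : ∀ (R : Type u) [CommRing R] [Algebra k R] (ρ : AutPlus R) (y : Jet p R),
    y ∈ P R → (ρ • y).base = y.base
  simply_transitive : ∀ (R : Type u) [CommRing R] [Algebra k R] (y y' : Jet p R),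
    y ∈ P R → y' ∈ P R → y.base = y'.base → ∃! ρ : AutPlus R, ρ • y = y'
  locally_trivial : ∀ c : C, ∃ (A : Type u) (_ : CommRing A) (_ : Algebra k A) (j : Pt p A),
    IsOpenImmersion j.1 ∧ c ∈ Set.range j.1 ∧
    ∃ ψ : ∀ (R : Type u) [CommRing R] [Algebra k R], (A →ₐ[k] R) → AutPlus R → Jet p R,
      IsTrivialization P j ψ

end Torsor

/-! ### The completion `𝒯_x R` -/

section Completion

variable {k R A : Type u} [Field k] [CommRing R] [Algebra k R] [CommRing A] [Algebra k A]

variable (k) in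
/-- `t` is a coordinate on `Spec A`: `Ω¹_A = A dt`. -/
def IsCoordinate (t : A) : Prop := Submodule.span A {D k A t} = ⊤

/-- The ideal `J_x` of `R ⊗ A`, for an `R`-point `x` of `Spec A`: the kernel of
`R ⊗ A → R`, `r ⊗ a ↦ r x(a)`. -/
def pointIdeal (x : A →ₐ[k] R) : Ideal (R ⊗[k] A) :=
  RingHom.ker (Algebra.TensorProduct.lift (AlgHom.id R R) x fun _ _ => Commute.all _ _)

/-- `𝒯_x R = lim_n (R ⊗ A) / J_xⁿ`. -/
abbrev PtCompletion (x : A →ₐ[k] R) : Type u := AdicCompletion (pointIdeal x) (R ⊗[k] A)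

/-- The topology of `𝒯_x R`: the inverse limit of the discrete topologies. -/
abbrev completionTop (x : A →ₐ[k] R) : TopologicalSpace (PtCompletion x) :=
  ⨅ n : ℕ, TopologicalSpace.induced (AdicCompletion.evalₐ (pointIdeal x) n) ⊥

/-- The isomorphisms of topological `R`-algebras `φ : 𝒯_x R ≃ R[[z]]` with
`φ(J_x) ⊆ z R[[z]]`. -/
def FormalIso (x : A →ₐ[k] R) : Type u :=
  {φ : PtCompletion x ≃ₐ[R] R⟦X⟧ // Continuous[completionTop x, zTop R] φ ∧
    Continuous[zTop R, completionTop x] φ.symm ∧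
    ∀ a ∈ pointIdeal x, φ (algebraMap (R ⊗[k] A) (PtCompletion x) a) ∈ maxIdeal R}

/-- `(ρ, φ) ↦ ρ ∘ φ`. -/
def FormalIso.act {x : A →ₐ[k] R} (ρ : AutPlus R) (φ : FormalIso x) : FormalIso x :=
  ⟨φ.1.trans ρ.1, by
    let := zTop R
    let := completionTop x
    exact ⟨ρ.2.1.comp φ.2.1, φ.2.2.1.comp ρ.2.2.1, fun a ha => ρ.2.2.2 _ (φ.2.2.2 a ha)⟩⟩

/-- `φ : 𝒯_x R ≃ R[[z]]` is the isomorphism `ρ^x_t`, i.e. `φ⁻¹(z) = t - x(t)`. -/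
def FormalIso.IsRho {x : A →ₐ[k] R} (t : A) (φ : FormalIso x) : Prop :=
  φ.1.symm X = algebraMap (R ⊗[k] A) (PtCompletion x) (1 ⊗ₜ[k] t - x t ⊗ₜ[k] 1)

/-- The `k`-algebra map `A → R ⊗ A → 𝒯_x R → R[[z]]` defined by `φ : 𝒯_x R ≃ R[[z]]`. -/
def FormalIso.toHom {x : A →ₐ[k] R} (φ : FormalIso x) : A →ₐ[k] R⟦X⟧ :=
  (φ.1.toAlgHom.restrictScalars k).comp
    ((IsScalarTower.toAlgHom k (R ⊗[k] A) (PtCompletion x)).comp Algebra.TensorProduct.includeRight)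

variable {C : Scheme.{u}} {p : C ⟶ Spec (CommRingCat.of k)}

/-- The jet of `C` defined by a pair `(x, φ)`, where `x` is an `R`-point of an affine open
`j : Spec A ⟶ C` and `φ : 𝒯_x R ≃ R[[z]]`. -/
def FormalIso.toJet (j : Pt p A) {x : A →ₐ[k] R} (φ : FormalIso x) : Jet p R :=
  Pt.map φ.toHom j

end Completion

end CurveJets

end

open CurveJets

/-!
Over an affine open `Spec A` of `C`, a jet is a map `φ : A → R[[z]]`. Since `Ω¹_A` is locally
cyclic, a surjective pullback of differentials is bijective, and it is surjective exactly when
the coefficients of `z` in the series `φ a` generate the unit ideal of `R`. In characteristic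
`0` the relation `n zⁿ⁻¹ dz = 0` in `Ω¹` of `R[z]/zⁿ` only lowers the truncation order by one, which
disappears in the limit. The criterion does not depend on the chart, and it can be tested at the
residue fields of `R`.

If `t` is a coordinate and `∂_t t = 1`, then Taylor expansion along `∂_t` is the jet over `x` with
`t ↦ x(t) + z`. As `J_x = (t - x(t)) + J_x²`, it induces the isomorphism `ρ^x_t : 𝒯_x R ≃ R[[z]]`.
A jet over `x` is determined by the image of `t`, and by the criterion it is in `Aut_C(R)` iff this
image is `x(t) + ρ(z)` for some `ρ` in `Aut⁺O(R)`: so `ψ_t` is bijective. On all of `C`, the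
automorphisms obtained on a cover of `Spec R` by sets `D(f)` glue because they are unique.
-/

noncomputable section

namespace CurveJets

/-! ### Power series and their automorphisms -/

section AutPlus

variable {R S : Type u} [CommRing R] [CommRing S]

theorem mem_maxIdeal_iff {g : R⟦X⟧} : g ∈ maxIdeal R ↔ constantCoeff g = 0 := by
  rw [Ideal.mem_span_singleton, X_dvd_iff]

theorem X_mem_maxIdeal : (X : R⟦X⟧) ∈ maxIdeal R := Ideal.mem_span_singleton_self X

theorem mem_maxIdeal_pow_iff {g : R⟦X⟧} {n : ℕ} :
    g ∈ maxIdeal R ^ n ↔ ∀ m < n, coeff m g = 0 := by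
  rw [Ideal.span_singleton_pow, Ideal.mem_span_singleton, X_pow_dvd_iff]

theorem sub_C_mem_maxIdeal (g : R⟦X⟧) : g - C (constantCoeff g) ∈ maxIdeal R := by
  rw [mem_maxIdeal_iff, map_sub, constantCoeff_C, sub_self]

theorem sub_trunc_mem_maxIdeal_pow (n : ℕ) (g : R⟦X⟧) :
    g - (trunc n g : R⟦X⟧) ∈ maxIdeal R ^ n :=
  mem_maxIdeal_pow_iff.2 fun m hm => by
    rw [map_sub, Polynomial.coeff_coe, coeff_trunc, if_pos hm, sub_self]

theorem coeff_mul_of_mem_maxIdeal_pow {n : ℕ} (f : R⟦X⟧) {g : R⟦X⟧} (hg : g ∈ maxIdeal R ^ n) :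
    coeff n (f * g) = constantCoeff f * coeff n g := by
  rw [Ideal.span_singleton_pow, Ideal.mem_span_singleton] at hg
  obtain ⟨h, rfl⟩ := hg
  have coeff_self (p : R⟦X⟧) : coeff n (X ^ n * p) = constantCoeff p := by
    simpa using coeff_X_pow_mul p n 0
  rw [mul_left_comm, coeff_self, coeff_self, map_mul]

instance : IsAdicComplete (maxIdeal R) R⟦X⟧ where
  haus' f hf := by
    ext n
    have hn := hf (n + 1)
    rw [SModEq.zero, smul_eq_mul, Ideal.mul_top] at hn
    exact mem_maxIdeal_pow_iff.1 hn n n.lt_succ_self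
  prec' f hf := by
    refine ⟨mk fun n => coeff n (f (n + 1)), fun n => ?_⟩
    rw [SModEq.sub_mem, smul_eq_mul, Ideal.mul_top, mem_maxIdeal_pow_iff]
    intro m hm
    have h := hf (Nat.succ_le_of_lt hm)
    rw [SModEq.sub_mem, smul_eq_mul, Ideal.mul_top, mem_maxIdeal_pow_iff] at h
    rw [map_sub, coeff_mk, ← neg_sub, ← map_sub, h m m.lt_succ_self, neg_zero]

namespace AutPlus

theorem apply_C (ρ : AutPlus R) (r : R) : ρ.1 (C r) = C r := ρ.1.commutes r

theorem constantCoeff_apply (ρ : AutPlus R) (g : R⟦X⟧) :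
    constantCoeff (ρ.1 g) = constantCoeff g := by
  have h := ρ.2.2.2 _ (sub_C_mem_maxIdeal g)
  rwa [map_sub, apply_C, mem_maxIdeal_iff, map_sub, constantCoeff_C, sub_eq_zero] at h

theorem coeff_one_apply (ρ : AutPlus R) (g : R⟦X⟧) :
    coeff 1 (ρ.1 g) = coeff 1 (ρ.1 X) * coeff 1 g := by
  obtain ⟨h, hh⟩ := Ideal.mem_span_singleton.1 (sub_C_mem_maxIdeal g)
  have hg : g = C (constantCoeff g) + X * h := by rw [← hh, add_sub_cancel]
  rw [hg]
  simp only [map_add, map_mul, apply_C, coeff_one_mul, constantCoeff_apply, coeff_C, coeff_one_X,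
    constantCoeff_X, one_ne_zero, if_false]
  ring

theorem isUnit_coeff_one (ρ : AutPlus R) : IsUnit (coeff 1 (ρ.1 X)) := by
  refine IsUnit.of_mul_eq_one (coeff 1 ((ρ⁻¹).1 X)) ?_
  rw [← coeff_one_apply]
  exact (congrArg (coeff 1) (ρ.1.apply_symm_apply X)).trans coeff_one_X

theorem ext_X {ρ τ : AutPlus R} (h : ρ.1 X = τ.1 X) : ρ = τ :=
  Subtype.ext <| AlgEquiv.ext fun g =>
    DFunLike.congr_fun (algHom_ext ρ.1.toAlgHom τ.1.toAlgHom ρ.2.2.2 τ.2.2.2 h) g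

theorem map_apply_map (f : R →+* S) (ρ : AutPlus R) (g : R⟦X⟧) :
    (map f ρ).1 (PowerSeries.map f g) = PowerSeries.map f (ρ.1 g) :=
  mapHom_map f ρ g

theorem map_apply_X (f : R →+* S) (ρ : AutPlus R) :
    (map f ρ).1 X = PowerSeries.map f (ρ.1 X) :=
  mapHom_X f ρ

end AutPlus

theorem substAlgHom_mem_maxIdeal {g : R⟦X⟧} (hg : constantCoeff g = 0) {f : R⟦X⟧}
    (hf : f ∈ maxIdeal R) :
    substAlgHom (R := R) (HasSubst.of_constantCoeff_zero' hg) f ∈ maxIdeal R := by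
  rw [mem_maxIdeal_iff] at hf ⊢
  rw [coe_substAlgHom]
  exact constantCoeff_subst_eq_zero hg f hf

theorem substAlgHom_comp_eq_id {g h : R⟦X⟧} (hg : constantCoeff g = 0) (hh : constantCoeff h = 0)
    (hgh : h.subst g = X) :
    (substAlgHom (HasSubst.of_constantCoeff_zero' hg)).comp
      (substAlgHom (HasSubst.of_constantCoeff_zero' hh)) = AlgHom.id R R⟦X⟧ := by
  refine algHom_ext _ _ (fun f hf => substAlgHom_mem_maxIdeal hg (substAlgHom_mem_maxIdeal hh hf))
    (fun f hf => hf) ?_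
  rw [AlgHom.comp_apply, substAlgHom_X, coe_substAlgHom, hgh, AlgHom.id_apply]

theorem AutPlus.exists_apply_X {g : R⟦X⟧} (hg₀ : constantCoeff g = 0)
    (hg₁ : IsUnit (coeff 1 g)) : ∃ ρ : AutPlus R, ρ.1 X = g := by
  have hi : constantCoeff (g.substInvOfIsUnit hg₁) = 0 := by simp
  refine ⟨⟨AlgEquiv.ofAlgHom _ _
    (substAlgHom_comp_eq_id hg₀ hi (subst_substInvOfIsUnit_left g hg₀ hg₁))
    (substAlgHom_comp_eq_id hi hg₀ (subst_substInvOfIsUnit_right g hg₀ hg₁)),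
    continuous_of_map_mem _ fun _ => substAlgHom_mem_maxIdeal hg₀,
    continuous_of_map_mem _ fun _ => substAlgHom_mem_maxIdeal hi,
    fun _ => substAlgHom_mem_maxIdeal hg₀⟩, ?_⟩
  exact substAlgHom_X (HasSubst.of_constantCoeff_zero' hg₀)

end AutPlus

/-! ### Derivations and jets -/

section Leibniz

variable {k A : Type u} [Field k] [CommRing A] [Algebra k A]

theorem apply_mem_span_of_leibniz {S M : Type*} [CommRing S] [Algebra k S] [AddCommGroup M]
    [Module k M] [Module S M] [IsScalarTower k S M] {s : Set A}
    (hs : Submodule.span A (D k A '' s) = ⊤) (x : A →ₐ[k] S) (δ : A →ₗ[k] M)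
    (leibniz : ∀ a b, δ (a * b) = x a • δ b + x b • δ a) (a : A) :
    δ a ∈ Submodule.span S (δ '' s) := by
  let : Module A M := Module.compHom M x.toRingHom
  have smul_eq (b : A) (m : M) : b • m = x b • m := rfl
  have : IsScalarTower k A M := ⟨fun c b m => by
    rw [smul_eq, smul_eq, map_smul, smul_assoc]⟩
  let d : Derivation k A M := Derivation.mk' δ leibniz
  have d_apply (b : A) : d.liftKaehlerDifferential (D k A b) = δ b :=
    d.liftKaehlerDifferential_comp_D b
  have key : ∀ ω ∈ Submodule.span A (D k A '' s),
      d.liftKaehlerDifferential ω ∈ Submodule.span S (δ '' s) := fun ω hω => by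
    induction hω using Submodule.span_induction with
    | mem _ h =>
      obtain ⟨b, hb, rfl⟩ := h
      exact d_apply b ▸ Submodule.subset_span ⟨b, hb, rfl⟩
    | zero => exact map_zero d.liftKaehlerDifferential ▸ Submodule.zero_mem _
    | add ω ω' _ _ h h' => exact map_add d.liftKaehlerDifferential ω ω' ▸ Submodule.add_mem _ h h'
    | smul b ω _ h =>
      exact map_smul d.liftKaehlerDifferential b ω ▸ Submodule.smul_mem _ (x b) h
  exact d_apply a ▸ key _ (hs ▸ Submodule.mem_top)

theorem IsCoordinate.apply_mem_span {S M : Type*} [CommRing S] [Algebra k S] [AddCommGroup M]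
    [Module k M] [Module S M] [IsScalarTower k S M] {t : A} (ht : IsCoordinate k t)
    (x : A →ₐ[k] S) (δ : A →ₗ[k] M) (leibniz : ∀ a b, δ (a * b) = x a • δ b + x b • δ a) (a : A) :
    δ a ∈ Submodule.span S {δ t} := by
  rw [← Set.image_singleton]
  exact apply_mem_span_of_leibniz (by rwa [Set.image_singleton]) x δ leibniz a

theorem IsCoordinate.isUnit_derivation {t s : A} (hs : IsCoordinate k s) {d : Derivation k A A}
    (hd : d t = 1) : IsUnit (d s) := by
  have h := hs.apply_mem_span (AlgHom.id k A) d.toLinearMap d.leibniz t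
  obtain ⟨c, hc⟩ := Submodule.mem_span_singleton.1 h
  exact IsUnit.of_mul_eq_one_right c (hc.trans hd)

theorem span_D_image_range_algebraMap (k A B : Type u) [Field k] [CommRing A] [Algebra k A]
    [CommRing B] [Algebra k B] [Algebra A B] [IsScalarTower k A B]
    [Algebra.FormallyUnramified A B] :
    Submodule.span B (D k B '' Set.range (algebraMap A B)) = ⊤ := by
  have surjective : LinearMap.range (KaehlerDifferential.mapBaseChange k A B) = ⊤ := by
    rw [KaehlerDifferential.range_mapBaseChange, LinearMap.ker_eq_top]
    exact LinearMap.ext fun _ => Subsingleton.elim _ _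
  rw [← top_le_iff, ← surjective]
  rintro _ ⟨w, rfl⟩
  induction w using TensorProduct.induction_on with
  | zero => simp only [map_zero, Submodule.zero_mem]
  | add v w hv hw => exact map_add (mapBaseChange k A B) v w ▸ Submodule.add_mem _ hv hw
  | tmul b ω =>
    rw [KaehlerDifferential.mapBaseChange_tmul]
    refine Submodule.smul_mem _ _ ?_
    have hω : ω ∈ Submodule.span A (Set.range (D k A)) := by
      rw [KaehlerDifferential.span_range_derivation]; trivial
    induction hω using Submodule.span_induction with
    | mem _ h =>
      obtain ⟨a, rfl⟩ := h
      exact Submodule.subset_span ⟨_, ⟨a, rfl⟩, (KaehlerDifferential.map_D k k A B a).symm⟩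
    | zero => simp only [map_zero, Submodule.zero_mem]
    | add ω ω' _ _ h h' => rw [map_add]; exact Submodule.add_mem _ h h'
    | smul a ω _ h => rw [map_smul]; exact Submodule.smul_of_tower_mem _ a h

end Leibniz

section JetIdeal

variable {k R S A B : Type u} [Field k] [CommRing R] [Algebra k R] [CommRing S] [Algebra k S]
  [CommRing A] [Algebra k A] [CommRing B] [Algebra k B]

theorem IsCoordinate.jet_ext {t : A} (ht : IsCoordinate k t) {φ ψ : A →ₐ[k] R⟦X⟧}
    (h₀ : ∀ a, constantCoeff (φ a) = constantCoeff (ψ a)) (h : φ t = ψ t) : φ = ψ := by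
  suffices H : ∀ n a, coeff n (φ a - ψ a) = 0 from
    AlgHom.ext fun a => sub_eq_zero.1 (PowerSeries.ext fun n => H n a)
  intro n
  induction n using Nat.strong_induction_on with
  | _ n ih =>
    have mem_pow (a : A) : φ a - ψ a ∈ maxIdeal R ^ n :=
      mem_maxIdeal_pow_iff.2 fun m hm => ih m hm a
    -- As `φ` and `ψ` agree modulo `zⁿ`, the coefficient of `zⁿ` in `φ - ψ` is a derivation.
    have key := ht.apply_mem_span ((evalZero k R).comp φ)
      ((coeff n).restrictScalars k ∘ₗ (φ.toLinearMap - ψ.toLinearMap)) fun a b => by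
        change coeff n (φ (a * b) - ψ (a * b)) =
          constantCoeff (φ a) * coeff n (φ b - ψ b) + constantCoeff (φ b) * coeff n (φ a - ψ a)
        rw [h₀ b, ← coeff_mul_of_mem_maxIdeal_pow _ (mem_pow b),
          ← coeff_mul_of_mem_maxIdeal_pow _ (mem_pow a), ← map_add, map_mul, map_mul]
        ring_nf
    intro a
    obtain ⟨r, hr⟩ := Submodule.mem_span_singleton.1 (key a)
    change r • coeff n (φ t - ψ t) = coeff n (φ a - ψ a) at hr
    rw [← hr, h, sub_self, map_zero, smul_zero]

/-- The ideal of `R` generated by the derivatives at `z = 0` of the functions on a jet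
`φ : A → R[[z]]`. The jet is étale precisely when it is the unit ideal. -/
def jetIdeal (φ : A →ₐ[k] R⟦X⟧) : Ideal R := Ideal.span (Set.range fun a => coeff 1 (φ a))

theorem coeff_one_mem_jetIdeal (φ : A →ₐ[k] R⟦X⟧) (a : A) : coeff 1 (φ a) ∈ jetIdeal φ :=
  Ideal.subset_span ⟨a, rfl⟩

theorem jetIdeal_le_iff {φ : A →ₐ[k] R⟦X⟧} {I : Ideal R} :
    jetIdeal φ ≤ I ↔ ∀ a, coeff 1 (φ a) ∈ I :=
  Ideal.span_le.trans Set.range_subset_iff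

theorem jetIdeal_map (f : R →ₐ[k] S) (φ : A →ₐ[k] R⟦X⟧) :
    jetIdeal ((PowerSeries.mapAlgHom f).comp φ) = (jetIdeal φ).map f := by
  rw [jetIdeal, jetIdeal, Ideal.map_span, ← Set.range_comp]
  rfl

theorem jetIdeal_smul_le (ρ : AutPlus R) (φ : A →ₐ[k] R⟦X⟧) :
    jetIdeal ((ρ.1.toAlgHom.restrictScalars k).comp φ) ≤ jetIdeal φ :=
  jetIdeal_le_iff.2 fun a =>
    (AutPlus.coeff_one_apply ρ (φ a)).symm ▸ Ideal.mul_mem_left _ _ (coeff_one_mem_jetIdeal φ a)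

theorem jetIdeal_le_span {s : Set A} (hs : Submodule.span A (D k A '' s) = ⊤)
    (φ : A →ₐ[k] R⟦X⟧) : jetIdeal φ ≤ Ideal.span ((fun a => coeff 1 (φ a)) '' s) := by
  let δ : A →ₗ[k] R := (coeff 1).restrictScalars k ∘ₗ φ.toLinearMap
  have leibniz (a b : A) : δ (a * b) =
      ((evalZero k R).comp φ) a • δ b + ((evalZero k R).comp φ) b • δ a := by
    change coeff 1 (φ (a * b)) =
      constantCoeff (φ a) * coeff 1 (φ b) + constantCoeff (φ b) * coeff 1 (φ a)
    rw [map_mul, coeff_one_mul]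
    ring
  exact jetIdeal_le_iff.2 fun a => apply_mem_span_of_leibniz hs _ δ leibniz a

theorem jetIdeal_eq_top_iff {t : A} (ht : IsCoordinate k t) (φ : A →ₐ[k] R⟦X⟧) :
    jetIdeal φ = ⊤ ↔ IsUnit (coeff 1 (φ t)) := by
  rw [← Ideal.span_singleton_eq_top]
  have hle : jetIdeal φ ≤ Ideal.span {coeff 1 (φ t)} := by
    rw [← Set.image_singleton (f := fun a => coeff 1 (φ a))]
    exact jetIdeal_le_span (by rwa [Set.image_singleton]) φ
  rw [hle.antisymm ((Ideal.span_singleton_le_iff_mem _).2 (coeff_one_mem_jetIdeal φ t))]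

theorem jetIdeal_comp (i : A →ₐ[k] B) (hi : i.toRingHom.FormallyUnramified) (φ : B →ₐ[k] R⟦X⟧) :
    jetIdeal (φ.comp i) = jetIdeal φ := by
  let : Algebra A B := i.toRingHom.toAlgebra
  have : IsScalarTower k A B := IsScalarTower.of_algebraMap_eq fun c => (i.commutes c).symm
  have : Algebra.FormallyUnramified A B := hi
  refine (jetIdeal_le_iff.2 fun a => coeff_one_mem_jetIdeal φ (i a)).antisymm ?_
  refine (jetIdeal_le_span (span_D_image_range_algebraMap k A B) φ).trans_eq ?_
  rw [← Set.range_comp]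
  rfl

end JetIdeal

/-! ### Taylor expansion along a derivation -/

section Taylor

variable {k R A : Type u} [Field k] [CommRing A] [Algebra k A] [CommRing R] [Algebra k R]

/-- The Taylor series `∑ dⁿ(a) zⁿ / n!` of `a` along the derivation `d`. -/
def taylorSeries (d : Derivation k A A) (a : A) : A⟦X⟧ :=
  PowerSeries.mk fun n => algebraMap k A (n.factorial : k)⁻¹ * d^[n] a

theorem coeff_taylorSeries (d : Derivation k A A) (a : A) (n : ℕ) :
    coeff n (taylorSeries d a) = algebraMap k A (n.factorial : k)⁻¹ * d^[n] a :=
  coeff_mk _ _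

theorem C_add_mk_eq_taylorSeries (d : Derivation k A A) (a : A) :
    C a + PowerSeries.mk
      (fun n => if n = 0 then 0 else algebraMap k A (n.factorial : k)⁻¹ * d^[n] a) =
        taylorSeries d a := by
  ext n
  rw [map_add, coeff_C, coeff_mk, coeff_taylorSeries]
  split_ifs with hn
  · subst hn
    simp
  · exact zero_add _

theorem taylorSeries_add (d : Derivation k A A) (a b : A) :
    taylorSeries d (a + b) = taylorSeries d a + taylorSeries d b := by
  ext n
  simp only [coeff_taylorSeries, map_add, iterate_map_add, mul_add]

theorem taylorSeries_algebraMap (d : Derivation k A A) (c : k) :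
    taylorSeries d (algebraMap k A c) = algebraMap k A⟦X⟧ c := by
  ext n
  rw [IsScalarTower.algebraMap_apply k A A⟦X⟧, ← C_eq_algebraMap, coeff_taylorSeries]
  cases n with
  | zero => simp
  | succ n => simp

theorem isUnit_natCast (k : Type*) {A : Type*} [Field k] [CharZero k] [CommRing A] [Algebra k A]
    {n : ℕ} (hn : n ≠ 0) : IsUnit (n : A) := by
  simpa using (Nat.cast_ne_zero (R := k).2 hn).isUnit.map (algebraMap k A)

variable [CharZero k]

theorem derivative_taylorSeries (d : Derivation k A A) (a : A) :
    derivative A (taylorSeries d a) = taylorSeries d (d a) := by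
  ext n
  have h : ((n + 1).factorial : k)⁻¹ * ((n + 1 : ℕ) : k) = (n.factorial : k)⁻¹ := by
    rw [Nat.factorial_succ, Nat.cast_mul, mul_inv_rev,
      inv_mul_cancel_right₀ (Nat.cast_ne_zero.2 n.succ_ne_zero)]
  rw [coeff_derivative, coeff_taylorSeries, coeff_taylorSeries, Function.iterate_succ_apply, ← h,
    map_mul, map_natCast]
  push_cast
  ring

theorem taylorSeries_mul (d : Derivation k A A) (a b : A) :
    taylorSeries d (a * b) = taylorSeries d a * taylorSeries d b := by
  ext n
  induction n generalizing a b with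
  | zero => simp [taylorSeries]
  | succ n ih =>
    have isUnit_succ : IsUnit ((n : A) + 1) := by
      exact_mod_cast isUnit_natCast k (A := A) n.succ_ne_zero
    apply isUnit_succ.mul_right_cancel
    rw [← coeff_derivative, ← coeff_derivative, derivative_taylorSeries, Derivation.leibniz,
      Derivation.leibniz, derivative_taylorSeries, derivative_taylorSeries, taylorSeries_add,
      map_add, map_add, smul_eq_mul, smul_eq_mul, smul_eq_mul, smul_eq_mul, ih, ih]

/-- The homomorphism `exp(z d)`, sending `a` to its Taylor series along `d`. -/
def taylorHom (d : Derivation k A A) : A →ₐ[k] A⟦X⟧ where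
  toFun := taylorSeries d
  map_one' := by simpa using taylorSeries_algebraMap d 1
  map_mul' := taylorSeries_mul d
  map_zero' := by simpa using taylorSeries_algebraMap d 0
  map_add' := taylorSeries_add d
  commutes' := taylorSeries_algebraMap d

/-- The jet at the point `x` given by Taylor expansion along `d`. -/
def taylorAt (d : Derivation k A A) (x : A →ₐ[k] R) : A →ₐ[k] R⟦X⟧ :=
  (PowerSeries.mapAlgHom x).comp (taylorHom d)

theorem taylorAt_apply (d : Derivation k A A) (x : A →ₐ[k] R) (a : A) :
    taylorAt d x a = PowerSeries.map x.toRingHom (taylorSeries d a) := rfl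

theorem constantCoeff_taylorAt (d : Derivation k A A) (x : A →ₐ[k] R) (a : A) :
    constantCoeff (taylorAt d x a) = x a := by
  rw [taylorAt_apply, ← coeff_zero_eq_constantCoeff_apply, coeff_map, coeff_taylorSeries]
  simp

theorem taylorAt_coordinate (d : Derivation k A A) (x : A →ₐ[k] R) {t : A} (h : d t = 1) :
    taylorAt d x t = C (x t) + X := by
  rw [taylorAt_apply]
  ext n
  rw [coeff_map, coeff_taylorSeries]
  rcases n with - | - | n
  · simp
  · simp [h]
  · simp [h, coeff_X]

end Taylor

/-! ### Maps that become isomorphisms after completion -/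

section Completion

open AdicCompletion

theorem adicTopology_eq_iInf_induced {S : Type*} [CommRing S] (I : Ideal S) :
    I.adicTopology = ⨅ n : ℕ, TopologicalSpace.induced (Ideal.Quotient.mk (I ^ n)) ⊥ := by
  refine TopologicalSpace.ext_nhds fun x => ?_
  have hbasis := I.hasBasis_nhds_adic x
  rw [hbasis.eq_iInf, nhds_iInf]
  refine iInf_congr fun n => ?_
  let : TopologicalSpace (S ⧸ I ^ n) := ⊥
  have : DiscreteTopology (S ⧸ I ^ n) := ⟨rfl⟩
  rw [nhds_induced, nhds_discrete, ← Filter.principal_singleton, Filter.comap_principal]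
  congr 1
  ext y
  simp only [Set.mem_image, SetLike.mem_coe, Set.mem_preimage, Set.mem_singleton_iff,
    Ideal.Quotient.eq]
  exact ⟨fun ⟨z, hz, hzy⟩ => by rwa [← hzy, add_sub_cancel_left],
    fun h => ⟨y - x, h, add_sub_cancel x y⟩⟩

variable {R B S : Type*} [CommRing R] [CommRing B] [Algebra R B] [CommRing S] [Algebra R S]
  {J : Ideal B} {I : Ideal S} {T : B →ₐ[R] S}

/-- The isomorphism `B / Jⁿ ≃ S / Iⁿ` induced by a homomorphism `T : B → S` with dense image which
pulls `Iⁿ` back to `Jⁿ`. -/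
def quotientPowEquiv (hT : ∀ n, (I ^ n).comap T = J ^ n)
    (dense : ∀ n g, ∃ b, g - T b ∈ I ^ n) (n : ℕ) : (B ⧸ J ^ n) ≃ₐ[R] S ⧸ I ^ n :=
  AlgEquiv.ofBijective (Ideal.quotientMapₐ (I ^ n) T (hT n).ge)
    ⟨Ideal.quotientMap_injective' (H := (hT n).ge) (hT n).le, fun g => by
      obtain ⟨g, rfl⟩ := Ideal.Quotient.mk_surjective g
      obtain ⟨b, hb⟩ := dense n g
      exact ⟨Ideal.Quotient.mk _ b, (Ideal.Quotient.eq.2 hb).symm⟩⟩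

variable (hT : ∀ n, (I ^ n).comap T = J ^ n) (dense : ∀ n g, ∃ b, g - T b ∈ I ^ n)

/-- The homomorphism from the `J`-adic completion of `B` to `S / Iⁿ` induced by `T : B → S`. -/
def evalQuotientPow (n : ℕ) : AdicCompletion J B →ₐ[R] S ⧸ I ^ n :=
  (quotientPowEquiv hT dense n).toAlgHom.comp ((evalₐ J n).restrictScalars R)

theorem factor_comp_evalQuotientPow {m n : ℕ} (hmn : m ≤ n) :
    (Ideal.Quotient.factorₐ R (Ideal.pow_le_pow_right hmn)).comp (evalQuotientPow hT dense n) =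
      evalQuotientPow hT dense m := by
  refine AlgHom.ext fun c => ?_
  obtain ⟨c, rfl⟩ := AdicCompletion.mk_surjective J B c
  exact congrArg (quotientPowEquiv hT dense m) (AdicCompletion.Ideal.mk_eq_mk J hmn c)

theorem eq_of_forall_mk_pow_eq [IsHausdorff I S] {g h : S}
    (H : ∀ n, Ideal.Quotient.mk (I ^ n) g = Ideal.Quotient.mk (I ^ n) h) : g = h := by
  refine (IsHausdorff.eq_iff_smodEq (I := I)).2 fun n => ?_
  rw [SModEq.sub_mem, smul_eq_mul, Ideal.mul_top]
  exact Ideal.Quotient.eq.1 (H n)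

variable [IsAdicComplete I S]

/-- The extension of `T : B → S` to the `J`-adic completion of `B`, for an `I`-adically
complete `S`. -/
def completionHom : AdicCompletion J B →ₐ[R] S :=
  IsAdicComplete.liftAlgHom I (evalQuotientPow hT dense) (factor_comp_evalQuotientPow hT dense)

theorem mk_completionHom (n : ℕ) (c : AdicCompletion J B) :
    Ideal.Quotient.mk (I ^ n) (completionHom hT dense c) =
      quotientPowEquiv hT dense n (evalₐ J n c) :=
  IsAdicComplete.mk_liftAlgHom I _ (factor_comp_evalQuotientPow hT dense) n c

theorem completionHom_algebraMap (b : B) :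
    completionHom hT dense (algebraMap B (AdicCompletion J B) b) = T b :=
  eq_of_forall_mk_pow_eq (I := I) fun n => by
    rw [mk_completionHom, AlgHom.commutes]
    rfl

theorem completionHom_bijective : Function.Bijective (completionHom hT dense) := by
  refine ⟨fun c c' h => ext_evalₐ fun n => (quotientPowEquiv hT dense n).injective ?_,
    fun g => ?_⟩
  · rw [← mk_completionHom, h, mk_completionHom]
  · choose b hb using fun n => dense n g
    have cauchy (n : ℕ) : b n ≡ b (n + 1) [SMOD (J ^ n • ⊤ : Submodule B B)] := by
      rw [SModEq.sub_mem, smul_eq_mul, Ideal.mul_top, ← hT, Ideal.mem_comap, map_sub]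
      rw [← sub_sub_sub_cancel_left]
      exact sub_mem (Ideal.pow_le_pow_right n.le_succ (hb (n + 1))) (hb n)
    refine ⟨AdicCompletion.mk J B (AdicCauchySequence.mk J B b cauchy),
      eq_of_forall_mk_pow_eq (I := I) fun n => ?_⟩
    rw [mk_completionHom, evalₐ_mk]
    exact (Ideal.Quotient.eq.2 (hb n)).symm

/-- The isomorphism with `S` of the `J`-adic completion of `B`, for an `I`-adically complete
`S`. -/
def completionEquiv : AdicCompletion J B ≃ₐ[R] S :=
  AlgEquiv.ofBijective (completionHom hT dense) (completionHom_bijective hT dense)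

theorem completionEquiv_algebraMap (b : B) :
    completionEquiv hT dense (algebraMap B (AdicCompletion J B) b) = T b :=
  completionHom_algebraMap hT dense b

theorem induced_completionEquiv :
    I.adicTopology.induced (completionEquiv hT dense) =
      ⨅ n : ℕ, TopologicalSpace.induced (evalₐ J n) ⊥ := by
  rw [adicTopology_eq_iInf_induced, induced_iInf]
  refine iInf_congr fun n => ?_
  have comp_eq : Ideal.Quotient.mk (I ^ n) ∘ completionEquiv hT dense =
      quotientPowEquiv hT dense n ∘ evalₐ J n := funext (mk_completionHom hT dense n)
  have induced_bot : TopologicalSpace.induced (quotientPowEquiv hT dense n) ⊥ = ⊥ := by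
    let : TopologicalSpace (S ⧸ I ^ n) := ⊥
    have : DiscreteTopology (S ⧸ I ^ n) := ⟨rfl⟩
    let := TopologicalSpace.induced (quotientPowEquiv hT dense n) ⊥
    exact (DiscreteTopology.of_continuous_injective continuous_induced_dom
      (quotientPowEquiv hT dense n).injective).eq_bot
  rw [induced_compose, comp_eq, ← induced_compose, induced_bot]

end Completion

/-! ### The ideal of a point and the formal coordinate -/

theorem pow_le_span_singleton_sup {B : Type*} [CommRing B] {J : Ideal B} {τ : B} (hτ : τ ∈ J)
    (hJ : J ≤ Ideal.span {τ} ⊔ J ^ 2) (n : ℕ) : J ^ n ≤ Ideal.span {τ ^ n} ⊔ J ^ (n + 1) := by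
  induction n with
  | zero => simp
  | succ n ih =>
    have span_le : Ideal.span {τ} ≤ J := (Ideal.span_singleton_le_iff_mem _).2 hτ
    rw [← Ideal.span_singleton_pow] at ih ⊢
    set T := Ideal.span {τ}
    have tail_le : T ^ n * J ^ 2 ≤ J ^ (n + 2) :=
      pow_add J n 2 ▸ Ideal.mul_mono_left (Ideal.pow_right_mono span_le n)
    calc J ^ (n + 1) = J ^ n * J := pow_succ J n
      _ ≤ (T ^ n ⊔ J ^ (n + 1)) * J := Ideal.mul_mono_left ih
      _ = T ^ n * J ⊔ J ^ (n + 2) := by rw [Ideal.sup_mul, ← pow_succ]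
      _ ≤ T ^ n * (T ⊔ J ^ 2) ⊔ J ^ (n + 2) := sup_le_sup_right (Ideal.mul_mono_right hJ) _
      _ = T ^ (n + 1) ⊔ T ^ n * J ^ 2 ⊔ J ^ (n + 2) := by rw [Ideal.mul_sup, ← pow_succ]
      _ ≤ T ^ (n + 1) ⊔ J ^ (n + 2) :=
        sup_le (sup_le le_sup_left (tail_le.trans le_sup_right)) le_sup_right

section Uniformizer

variable {R : Type u} {B : Type*} [CommRing R] [CommRing B] [Algebra R B] {T : B →ₐ[R] R⟦X⟧} {τ : B}

theorem comap_maxIdeal_pow {J : Ideal B} (hτ : T τ = X) (hT : (maxIdeal R).comap T = J)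
    (hJ : J ≤ Ideal.span {τ} ⊔ J ^ 2) (n : ℕ) : (maxIdeal R ^ n).comap T = J ^ n := by
  have hτJ : τ ∈ J := hT ▸ Ideal.mem_comap.2 (hτ ▸ X_mem_maxIdeal)
  have pow_le (n : ℕ) : J ^ n ≤ (maxIdeal R ^ n).comap T := hT ▸ Ideal.le_comap_pow _ n
  refine le_antisymm ?_ (pow_le n)
  induction n with
  | zero => simp
  | succ n ih =>
    intro b hb
    obtain ⟨_, hc, e, he, rfl⟩ := Submodule.mem_sup.1 (pow_le_span_singleton_sup hτJ hJ n
      (ih (Ideal.pow_le_pow_right n.le_succ hb)))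
    obtain ⟨c, rfl⟩ := Ideal.mem_span_singleton.1 hc
    have coeff_eq_zero : coeff n (T c * X ^ n) = 0 := by
      rw [Submodule.add_mem_iff_left _ (pow_le _ he), Ideal.mem_comap, map_mul, map_pow, hτ,
        mul_comm] at hb
      exact mem_maxIdeal_pow_iff.1 hb n n.lt_succ_self
    rw [coeff_mul_of_mem_maxIdeal_pow _ (Ideal.pow_mem_pow X_mem_maxIdeal n), coeff_X_pow_self,
      mul_one] at coeff_eq_zero
    refine add_mem ?_ he
    rw [pow_succ]
    exact Ideal.mul_mem_mul (Ideal.pow_mem_pow hτJ n)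
      (hT ▸ Ideal.mem_comap.2 (mem_maxIdeal_iff.2 coeff_eq_zero))

theorem exists_sub_mem_maxIdeal_pow (hτ : T τ = X) (n : ℕ) (g : R⟦X⟧) :
    ∃ b, g - T b ∈ maxIdeal R ^ n := by
  have aeval_X : (Polynomial.aeval X : Polynomial R →ₐ[R] R⟦X⟧) =
      Polynomial.coeToPowerSeries.algHom R :=
    Polynomial.algHom_ext (by simp)
  refine ⟨Polynomial.aeval τ (trunc n g), ?_⟩
  rw [← Polynomial.aeval_algHom_apply, hτ, aeval_X]
  simpa using sub_trunc_mem_maxIdeal_pow n g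

end Uniformizer

section PointIdeal

variable {k R A : Type u} [Field k] [CommRing R] [Algebra k R] [CommRing A] [Algebra k A]
  {x : A →ₐ[k] R} {t : A}

/-- The function `a - x(a)`, which vanishes at the point `x`. -/
def localParam (x : A →ₐ[k] R) : A →ₗ[k] R ⊗[k] A :=
  Algebra.TensorProduct.includeRight.toLinearMap -
    (Algebra.TensorProduct.includeLeft : R →ₐ[k] R ⊗[k] A).toLinearMap ∘ₗ x.toLinearMap

theorem localParam_apply (a : A) : localParam x a = 1 ⊗ₜ[k] a - x a ⊗ₜ[k] 1 := rfl

theorem localParam_mem (a : A) : localParam x a ∈ pointIdeal x := by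
  rw [pointIdeal, RingHom.mem_ker, localParam_apply, map_sub]
  simp

theorem localParam_mul (a b : A) : localParam x (a * b) =
    (1 ⊗ₜ[k] a) * localParam x b + (1 ⊗ₜ[k] b) * localParam x a -
      localParam x a * localParam x b := by
  have tmul_mul : (1 : R) ⊗ₜ[k] (a * b) = (1 ⊗ₜ[k] a) * (1 ⊗ₜ[k] b) := by simp
  have mul_tmul : x (a * b) ⊗ₜ[k] (1 : A) = (x a ⊗ₜ[k] 1) * (x b ⊗ₜ[k] 1) := by simp
  simp only [localParam_apply, tmul_mul, mul_tmul]
  ring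

theorem pointIdeal_le_span : pointIdeal x ≤ Ideal.span (Set.range (localParam x)) := by
  set ev := Algebra.TensorProduct.lift (AlgHom.id R R) x fun _ _ => Commute.all _ _
  have sub_mem_span (b : R ⊗[k] A) : b - ev b ⊗ₜ[k] 1 ∈ Ideal.span (Set.range (localParam x)) := by
    induction b using TensorProduct.induction_on with
    | zero => simp
    | add b c hb hc =>
      rw [map_add, TensorProduct.add_tmul, add_sub_add_comm]
      exact add_mem hb hc
    | tmul r a =>
      have eq_mul : r ⊗ₜ[k] a - ev (r ⊗ₜ[k] a) ⊗ₜ[k] 1 = (r ⊗ₜ[k] 1) * localParam x a := by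
        simp [ev, localParam_apply, mul_sub]
      rw [eq_mul]
      exact Ideal.mul_mem_left _ _ (Ideal.subset_span ⟨a, rfl⟩)
  intro b hb
  have hb : ev b = 0 := hb
  simpa [hb] using sub_mem_span b

/-- Modulo `J_x²` the function `a ↦ a - x(a)` is a derivation, hence a multiple of its value
at a coordinate. -/
theorem localParam_mem_span_sup (ht : IsCoordinate k t) (a : A) :
    localParam x a ∈ Ideal.span {localParam x t} ⊔ pointIdeal x ^ 2 := by
  set I : Ideal (R ⊗[k] A) := Ideal.span {localParam x t} ⊔ pointIdeal x ^ 2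
  let δ : A →ₗ[k] (R ⊗[k] A) ⧸ I := (Ideal.Quotient.mkₐ k I).toLinearMap ∘ₗ localParam x
  have leibniz (a b : A) : δ (a * b) = (1 ⊗ₜ[k] a : R ⊗[k] A) • δ b +
      (1 ⊗ₜ[k] b : R ⊗[k] A) • δ a := by
    have mul_mem : localParam x a * localParam x b ∈ I :=
      le_sup_right (a := Ideal.span {localParam x t})
        (pow_two (pointIdeal x) ▸ Ideal.mul_mem_mul (localParam_mem a) (localParam_mem b))
    change Ideal.Quotient.mk I _ = Ideal.Quotient.mk I (_ * _) + Ideal.Quotient.mk I (_ * _)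
    rw [← map_add, localParam_mul, Ideal.Quotient.eq, sub_sub_cancel_left]
    exact neg_mem mul_mem
  have δ_t : δ t = 0 := Ideal.Quotient.eq_zero_iff_mem.2
    (le_sup_left (b := pointIdeal x ^ 2) (Ideal.mem_span_singleton_self (localParam x t)))
  have δ_mem := ht.apply_mem_span (Algebra.TensorProduct.includeRight (R := k) (A := R)) δ
    leibniz a
  rw [δ_t, Submodule.span_zero_singleton, Submodule.mem_bot] at δ_mem
  exact Ideal.Quotient.eq_zero_iff_mem.1 δ_mem

theorem pointIdeal_le_span_sup (ht : IsCoordinate k t) :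
    pointIdeal x ≤ Ideal.span {localParam x t} ⊔ pointIdeal x ^ 2 :=
  pointIdeal_le_span.trans <| Ideal.span_le.2 <| Set.range_subset_iff.2 fun a =>
    localParam_mem_span_sup ht a

/-- The extension `R ⊗ A → R[[z]]` of a jet `A → R[[z]]`. -/
def jetLift (φ : A →ₐ[k] R⟦X⟧) : R ⊗[k] A →ₐ[R] R⟦X⟧ :=
  Algebra.TensorProduct.lift (Algebra.ofId R R⟦X⟧) φ fun _ _ => Commute.all _ _

variable {φ : A →ₐ[k] R⟦X⟧}

theorem jetLift_tmul (r : R) (a : A) : jetLift φ (r ⊗ₜ[k] a) = C r * φ a :=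
  Algebra.TensorProduct.lift_tmul ..

theorem jetLift_localParam (ht : φ t = C (x t) + X) : jetLift φ (localParam x t) = X := by
  rw [localParam_apply, map_sub, jetLift_tmul, jetLift_tmul, ht]
  simp

theorem comap_jetLift_maxIdeal (h₀ : ∀ a, constantCoeff (φ a) = x a) :
    (maxIdeal R).comap (jetLift φ) = pointIdeal x := by
  ext b
  rw [Ideal.mem_comap, mem_maxIdeal_iff, pointIdeal, RingHom.mem_ker]
  suffices h : constantCoeff (jetLift φ b) =
      Algebra.TensorProduct.lift (AlgHom.id R R) x (fun _ _ => Commute.all _ _) b by rw [h]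
  induction b using TensorProduct.induction_on with
  | zero => simp
  | add b c hb hc => rw [map_add, map_add, hb, hc, map_add]
  | tmul r a => simp [jetLift_tmul, h₀]

theorem FormalIso.exists_isRho (ht : IsCoordinate k t) (h₀ : ∀ a, constantCoeff (φ a) = x a)
    (hφ : φ t = C (x t) + X) : ∃ ψ : FormalIso x, ψ.IsRho t := by
  have hτ := jetLift_localParam hφ
  have hT := comap_maxIdeal_pow hτ (comap_jetLift_maxIdeal h₀) (pointIdeal_le_span_sup ht)
  have dense := exists_sub_mem_maxIdeal_pow hτ
  have hind := induced_completionEquiv hT dense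
  refine ⟨⟨completionEquiv hT dense, continuous_iff_le_induced.2 hind.ge, ?_, fun a ha => ?_⟩, ?_⟩
  · exact continuous_iff_coinduced_le.2
      ((congrFun (completionEquiv hT dense).toEquiv.coinduced_symm (zTop R)).trans hind).le
  · rw [completionEquiv_algebraMap, ← Ideal.mem_comap, comap_jetLift_maxIdeal h₀]
    exact ha
  · exact (AlgEquiv.symm_apply_eq _).2 ((completionEquiv_algebraMap hT dense _).trans hτ).symm

namespace FormalIso

theorem apply_algebraMap_tmul (φ : FormalIso x) (r : R) (a : A) :
    φ.1 (algebraMap (R ⊗[k] A) (PtCompletion x) (r ⊗ₜ[k] a)) = C r * φ.toHom a := by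
  have tmul_eq_smul : r ⊗ₜ[k] a = r • (1 ⊗ₜ[k] a : R ⊗[k] A) := by
    rw [TensorProduct.smul_tmul', smul_eq_mul, mul_one]
  rw [tmul_eq_smul, ← algebraMap_smul (R ⊗[k] A) r, smul_eq_mul, map_mul,
    ← IsScalarTower.algebraMap_apply R (R ⊗[k] A) (PtCompletion x), map_mul, AlgEquiv.commutes]
  rfl

theorem apply_localParam (φ : FormalIso x) (a : A) :
    φ.1 (algebraMap (R ⊗[k] A) (PtCompletion x) (localParam x a)) = φ.toHom a - C (x a) := by
  rw [localParam_apply, map_sub, map_sub, apply_algebraMap_tmul, apply_algebraMap_tmul, map_one,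
    one_mul, map_one, mul_one]

theorem constantCoeff_toHom (φ : FormalIso x) (a : A) : constantCoeff (φ.toHom a) = x a := by
  have h := φ.2.2.2 _ (localParam_mem a)
  rwa [apply_localParam, mem_maxIdeal_iff, map_sub, constantCoeff_C, sub_eq_zero] at h

theorem isRho_iff {φ : FormalIso x} : φ.IsRho t ↔ φ.toHom t = C (x t) + X := by
  have h : φ.IsRho t ↔ X = φ.toHom t - C (x t) := by
    rw [← apply_localParam, ← AlgEquiv.symm_apply_eq]
    rfl
  rw [h, eq_sub_iff_add_eq', eq_comm]

theorem toHom_act (ρ : AutPlus R) (φ : FormalIso x) (a : A) :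
    (act ρ φ).toHom a = ρ.1 (φ.toHom a) := rfl

theorem exists_act_eq (φ : FormalIso x) {ψ : FormalIso x} (hψ : ψ.IsRho t) :
    ∃ ρ : AutPlus R, act ρ ψ = φ := by
  let := zTop R
  let := completionTop x
  refine ⟨⟨ψ.1.symm.trans φ.1, φ.2.1.comp ψ.2.2.1, ψ.2.1.comp φ.2.2.1, fun g hg => ?_⟩,
    Subtype.ext <| AlgEquiv.ext fun c => congrArg φ.1 (ψ.1.symm_apply_apply c)⟩
  obtain ⟨h, rfl⟩ := Ideal.mem_span_singleton.1 hg
  rw [map_mul]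
  refine Ideal.mul_mem_right _ _ ?_
  change φ.1 (ψ.1.symm X) ∈ maxIdeal R
  rw [hψ]
  exact φ.2.2.2 _ (localParam_mem t)

theorem toHom_act_coordinate {ψ : FormalIso x} (hψ : ψ.IsRho t) (ρ : AutPlus R) :
    (act ρ ψ).toHom t = C (x t) + ρ.1 X := by
  rw [toHom_act, isRho_iff.1 hψ, map_add, AutPlus.apply_C]

theorem ext_coordinate {φ φ' ψ : FormalIso x} (hψ : ψ.IsRho t)
    (h : φ.toHom t = φ'.toHom t) : φ = φ' := by
  obtain ⟨ρ, rfl⟩ := φ.exists_act_eq hψ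
  obtain ⟨ρ', rfl⟩ := φ'.exists_act_eq hψ
  rw [toHom_act_coordinate hψ, toHom_act_coordinate hψ, add_right_inj] at h
  rw [AutPlus.ext_X h]

theorem isUnit_coeff_one_toHom (φ : FormalIso x) {ψ : FormalIso x} (hψ : ψ.IsRho t) :
    IsUnit (coeff 1 (φ.toHom t)) := by
  obtain ⟨ρ, rfl⟩ := φ.exists_act_eq hψ
  simpa [toHom_act_coordinate hψ, coeff_C] using AutPlus.isUnit_coeff_one ρ

theorem exists_toHom_act_eq (ht : IsCoordinate k t) {ψ : FormalIso x} (hψ : ψ.IsRho t)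
    (h₀ : ∀ a, constantCoeff (φ a) = x a) (h₁ : IsUnit (coeff 1 (φ t))) :
    ∃ ρ : AutPlus R, (act ρ ψ).toHom = φ := by
  obtain ⟨ρ, hρ⟩ := AutPlus.exists_apply_X (g := φ t - C (x t)) (by simp [h₀])
    (by simpa [coeff_C] using h₁)
  refine ⟨ρ, ht.jet_ext (fun a => ?_) ?_⟩
  · rw [constantCoeff_toHom, h₀]
  · rw [toHom_act_coordinate hψ, hρ, add_sub_cancel]

variable [CharZero k] {d : Derivation k A A}

theorem existsUnique_isRho (ht : IsCoordinate k t) (hd : d t = 1) (x : A →ₐ[k] R) :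
    ∃! φ : FormalIso x, φ.IsRho t := by
  obtain ⟨φ, hφ⟩ := exists_isRho ht (constantCoeff_taylorAt d x) (taylorAt_coordinate d x hd)
  exact ⟨φ, hφ, fun φ' hφ' =>
    ext_coordinate hφ ((isRho_iff.1 hφ').trans (isRho_iff.1 hφ).symm)⟩

theorem IsRho.toHom_eq_taylorAt (ht : IsCoordinate k t) (hd : d t = 1) {φ : FormalIso x}
    (hφ : φ.IsRho t) : φ.toHom = taylorAt d x :=
  ht.jet_ext (fun a => by rw [φ.constantCoeff_toHom, constantCoeff_taylorAt])
    (by rw [isRho_iff.1 hφ, taylorAt_coordinate d x hd])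

theorem IsRho.toHom_eq_act {s : A} (ht : IsCoordinate k t) (hs : IsCoordinate k s)
    (hd : d t = 1) {u : AutPlus A} (hu : C s + u.1 X = taylorSeries d s) {φ ψ : FormalIso x}
    (hφ : φ.IsRho t) (hψ : ψ.IsRho s) :
    φ.toHom = (act (AutPlus.map x.toRingHom u) ψ).toHom := by
  refine hs.jet_ext (fun a => by rw [constantCoeff_toHom, constantCoeff_toHom]) ?_
  rw [toHom_act_coordinate hψ, AutPlus.map_apply_X, hφ.toHom_eq_taylorAt ht hd, taylorAt_apply,
    ← hu, map_add, map_C]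
  rfl

end FormalIso

end PointIdeal

/-! ### Locally cyclic modules -/

section LocallyCyclic

universe v w

/-- An `A`-module is locally cyclic if it is generated by one element over each `D(g)`, for `g` in
a set generating the unit ideal of `A`. Such are the differentials on a smooth curve. Localization
at `g` is expressed by multiplying with powers of `g`. -/
def LocallyCyclic (A : Type v) (M : Type w) [CommRing A] [AddCommGroup M] [Module A M] : Prop :=
  ∃ s : Set A, Ideal.span s = ⊤ ∧ ∀ g ∈ s, ∃ e : M, ∀ m : M, ∃ (n : ℕ) (a : A), g ^ n • m = a • e

namespace LocallyCyclic

variable {A : Type v} {M : Type w} [CommRing A] [AddCommGroup M] [Module A M]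

theorem baseChange (B : Type*) [CommRing B] [Algebra A B] (hM : LocallyCyclic A M) :
    LocallyCyclic B (B ⊗[A] M) := by
  obtain ⟨s, hs, h⟩ := hM
  refine ⟨algebraMap A B '' s, by rw [← Ideal.map_span, hs, Ideal.map_top], ?_⟩
  rintro _ ⟨g, hg, rfl⟩
  obtain ⟨e, he⟩ := h g hg
  refine ⟨1 ⊗ₜ e, fun w => ?_⟩
  simp only [← map_pow, algebraMap_smul]
  induction w using TensorProduct.induction_on with
  | zero => exact ⟨0, 0, by rw [smul_zero, zero_smul]⟩
  | add v w hv hw =>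
    obtain ⟨n, b, hn⟩ := hv
    obtain ⟨n', b', hn'⟩ := hw
    refine ⟨n + n', g ^ n' • b + g ^ n • b', ?_⟩
    rw [pow_add, smul_add, mul_smul, mul_smul, smul_comm, hn, hn', add_smul, smul_assoc,
      smul_assoc]
  | tmul b m =>
    obtain ⟨n, a, hn⟩ := he m
    refine ⟨n, a • b, ?_⟩
    rw [← TensorProduct.tmul_smul, hn, TensorProduct.tmul_smul, smul_assoc,
      TensorProduct.smul_tmul' b, smul_eq_mul, mul_one]

theorem apply_smul_comm (hM : LocallyCyclic A M) (L : M →ₗ[A] A) (v w : M) :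
    L v • w = L w • v := by
  obtain ⟨s, hs, h⟩ := hM
  rw [← sub_eq_zero, ← Submodule.mem_bot A]
  refine Submodule.mem_of_span_eq_top_of_smul_pow_mem _ s hs _ fun ⟨g, hg⟩ => ?_
  obtain ⟨e, he⟩ := h g hg
  obtain ⟨n, a, hv⟩ := he v
  obtain ⟨n', b, hw⟩ := he w
  refine ⟨n + n', (Submodule.mem_bot A).2 ?_⟩
  calc g ^ (n + n') • (L v • w - L w • v)
      = L (g ^ n • v) • g ^ n' • w - L (g ^ n' • w) • g ^ n • v := by
        simp only [map_smul, smul_eq_mul, smul_sub, smul_smul]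
        ring_nf
    _ = 0 := by
        rw [hv, hw, sub_eq_zero]
        simp only [map_smul, smul_eq_mul, smul_smul]
        congr 1
        ring

theorem bijective_of_surjective (hM : LocallyCyclic A M) {L : M →ₗ[A] A}
    (hL : Function.Surjective L) : Function.Bijective L := by
  refine ⟨(injective_iff_map_eq_zero L).2 fun w hw => ?_, hL⟩
  obtain ⟨v, hv⟩ := hL 1
  rw [← one_smul A w, ← hv, hM.apply_smul_comm L v w, hw, zero_smul]

end LocallyCyclic

end LocallyCyclic

/-! ### Differentials of truncated power series -/

section TruncOmega

variable (R : Type u) [CommRing R]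

/-- The `R[z]/zⁿ⁺¹`-module structure of `R[z]/zⁿ`, which makes `d/dz` an `R[z]/zⁿ`-valued
derivation of `R[z]/zⁿ⁺¹`. -/
abbrev truncModule (n : ℕ) : Module (TruncPS R (n + 1)) (TruncPS R n) :=
  Module.compHom _ (Ideal.Quotient.factor (Ideal.pow_le_pow_right n.le_succ :
    maxIdeal R ^ (n + 1) ≤ maxIdeal R ^ n))

attribute [local instance] truncModule

instance truncModule_isScalarTower (n : ℕ) :
    IsScalarTower R (TruncPS R (n + 1)) (TruncPS R n) := ⟨fun r f g => by
  obtain ⟨f, rfl⟩ := Ideal.Quotient.mk_surjective f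
  obtain ⟨g, rfl⟩ := Ideal.Quotient.mk_surjective g
  exact congrArg (Ideal.Quotient.mk (maxIdeal R ^ n)) (smul_mul_assoc r f g)⟩

variable {R} in
theorem derivative_mem_maxIdeal_pow {n : ℕ} {f : R⟦X⟧} (hf : f ∈ maxIdeal R ^ (n + 1)) :
    derivative R f ∈ maxIdeal R ^ n :=
  mem_maxIdeal_pow_iff.2 fun m hm => by
    rw [coeff_derivative, mem_maxIdeal_pow_iff.1 hf (m + 1) (Nat.succ_lt_succ hm), zero_mul]

variable {R} in
theorem constantCoeff_derivative (f : R⟦X⟧) : constantCoeff (derivative R f) = coeff 1 f := by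
  rw [← coeff_zero_eq_constantCoeff_apply, coeff_derivative, Nat.cast_zero, zero_add, zero_add,
    mul_one]

/-- The derivation `d/dz : R[z]/zⁿ⁺¹ → R[z]/zⁿ`. -/
def truncDerivation (n : ℕ) : Derivation R (TruncPS R (n + 1)) (TruncPS R n) :=
  Derivation.mk'
    (Submodule.liftQ ((maxIdeal R ^ (n + 1)).restrictScalars R)
      ((Ideal.Quotient.mkₐ R (maxIdeal R ^ n)).toLinearMap ∘ₗ (derivative R).toLinearMap)
      fun _ hf => Ideal.Quotient.eq_zero_iff_mem.2 (derivative_mem_maxIdeal_pow hf))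
    fun f g => by
      obtain ⟨f, rfl⟩ := Ideal.Quotient.mk_surjective f
      obtain ⟨g, rfl⟩ := Ideal.Quotient.mk_surjective g
      exact congrArg (Ideal.Quotient.mk (maxIdeal R ^ n)) ((derivative R).leibniz f g)

/-- The map `Ω¹_{(R[z]/zⁿ⁺¹)/R} → R[z]/zⁿ`, `dz ↦ 1`. -/
def truncOmegaMap (n : ℕ) : Ω[TruncPS R (n + 1)⁄R] →ₗ[TruncPS R (n + 1)] TruncPS R n :=
  (truncDerivation R n).liftKaehlerDifferential

theorem truncOmegaMap_smul_D (n : ℕ) (f g : R⟦X⟧) :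
    truncOmegaMap R n (Ideal.Quotient.mk (maxIdeal R ^ (n + 1)) f •
      D R (TruncPS R (n + 1)) (Ideal.Quotient.mk _ g)) =
      Ideal.Quotient.mk _ (f * derivative R g) := by
  rw [map_smul, truncOmegaMap, Derivation.liftKaehlerDifferential_comp_D]
  rfl

theorem mk_eq_aeval_trunc (n : ℕ) (g : R⟦X⟧) : Ideal.Quotient.mk (maxIdeal R ^ n) g =
    Polynomial.aeval (Ideal.Quotient.mk (maxIdeal R ^ n) X) (trunc n g) := by
  have aeval_eq : Polynomial.aeval (Ideal.Quotient.mk (maxIdeal R ^ n) X) =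
      (Ideal.Quotient.mkₐ R (maxIdeal R ^ n)).comp (Polynomial.coeToPowerSeries.algHom R) :=
    Polynomial.algHom_ext (by simp)
  rw [aeval_eq]
  exact Ideal.Quotient.eq.2 (by simpa using sub_trunc_mem_maxIdeal_pow n g)

theorem exists_smul_D_eq (n : ℕ) (w : Ω[TruncPS R n⁄R]) : ∃ f : R⟦X⟧,
    Ideal.Quotient.mk (maxIdeal R ^ n) f • D R (TruncPS R n) (Ideal.Quotient.mk _ X) = w := by
  suffices h : ⊤ ≤ Submodule.span (TruncPS R n) {D R (TruncPS R n) (Ideal.Quotient.mk _ X)} by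
    obtain ⟨f, rfl⟩ := Submodule.mem_span_singleton.1 (h (x := w) trivial)
    obtain ⟨f, rfl⟩ := Ideal.Quotient.mk_surjective f
    exact ⟨f, rfl⟩
  rw [← KaehlerDifferential.span_range_derivation, Submodule.span_le]
  rintro _ ⟨g, rfl⟩
  obtain ⟨g, rfl⟩ := Ideal.Quotient.mk_surjective g
  rw [mk_eq_aeval_trunc R n g, SetLike.mem_coe, Derivation.map_aeval]
  exact Submodule.smul_mem _ _ (Submodule.mem_span_singleton_self _)

variable {R} in
theorem mk_smul_D_X_eq_zero (k : Type*) [Field k] [CharZero k] [Algebra k R] {n : ℕ} {f : R⟦X⟧}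
    (hf : f ∈ maxIdeal R ^ n) :
    Ideal.Quotient.mk (maxIdeal R ^ (n + 1)) f •
      D R (TruncPS R (n + 1)) (Ideal.Quotient.mk _ X) = 0 := by
  rw [Ideal.span_singleton_pow, Ideal.mem_span_singleton] at hf
  obtain ⟨h, rfl⟩ := hf
  have X_pow_eq_zero : (Ideal.Quotient.mk (maxIdeal R ^ (n + 1)) X) ^ (n + 1) = 0 := by
    rw [← map_pow, Ideal.Quotient.eq_zero_iff_mem]
    exact Ideal.pow_mem_pow X_mem_maxIdeal _
  -- `0 = d(zⁿ⁺¹) = (n + 1) zⁿ dz`, and `n + 1` is invertible.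
  have key := (D R (TruncPS R (n + 1))).leibniz_pow (Ideal.Quotient.mk _ X) (n + 1)
  rw [X_pow_eq_zero, map_zero, Nat.add_sub_cancel, ← Nat.cast_smul_eq_nsmul (TruncPS R (n + 1)),
    eq_comm, (isUnit_natCast k n.succ_ne_zero).smul_eq_zero] at key
  rw [mul_comm, map_mul, map_pow]
  exact (mul_smul (Ideal.Quotient.mk _ h) _ _).trans (by rw [key, smul_zero])

theorem truncOmegaMap_injective (k : Type*) [Field k] [CharZero k] [Algebra k R] (n : ℕ) :
    Function.Injective (truncOmegaMap R n) := by
  rw [injective_iff_map_eq_zero]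
  intro w hw
  obtain ⟨f, rfl⟩ := exists_smul_D_eq R (n + 1) w
  rw [truncOmegaMap_smul_D, derivative_X, mul_one, Ideal.Quotient.eq_zero_iff_mem] at hw
  exact mk_smul_D_X_eq_zero k hw

theorem omegaMap_smul_D (n : ℕ) (f g : R⟦X⟧) :
    omegaMap (Ideal.Quotient.factorₐ R (Ideal.pow_le_pow_right n.le_succ))
      (Ideal.Quotient.mk (maxIdeal R ^ (n + 1)) f •
        D R (TruncPS R (n + 1)) (Ideal.Quotient.mk _ g)) =
      Ideal.Quotient.mk (maxIdeal R ^ n) f • D R (TruncPS R n) (Ideal.Quotient.mk _ g) := by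
  simp only [omegaMap, LinearMap.restrictScalars_apply, map_smul, KaehlerDifferential.map_D]
  rfl

theorem factor_truncOmegaMap (n : ℕ) (w : Ω[TruncPS R (n + 2)⁄R]) :
    Ideal.Quotient.factor (Ideal.pow_le_pow_right n.le_succ :
      maxIdeal R ^ (n + 1) ≤ maxIdeal R ^ n) (truncOmegaMap R (n + 1) w) =
      truncOmegaMap R n (omegaMap
        (Ideal.Quotient.factorₐ R (Ideal.pow_le_pow_right (n + 1).le_succ)) w) := by
  obtain ⟨f, rfl⟩ := exists_smul_D_eq R (n + 2) w
  rw [omegaMap_smul_D, truncOmegaMap_smul_D, truncOmegaMap_smul_D, Ideal.Quotient.factor_mk]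

/-- The differential `dz` of `R[[z]]`. -/
def contOmegaDX : ContOmega R :=
  ⟨fun n => D R (TruncPS R n) (Ideal.Quotient.mk _ X), fun n => by
    simp only [omegaMap, LinearMap.restrictScalars_apply, KaehlerDifferential.map_D]
    rfl⟩

end TruncOmega

/-! ### Pullback of differentials along a jet -/

section PullbackOmega

attribute [local instance] truncModule

theorem tensorOmega_induction {k R A : Type u} [Field k] [CommRing R] [CommRing A] [Algebra k A]
    [Algebra A R⟦X⟧] {n : ℕ} {P : TruncPS R n ⊗[A] Ω[A⁄k] → Prop} (zero : P 0)
    (add : ∀ v w, P v → P w → P (v + w)) (tmul : ∀ (b : R⟦X⟧) a,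
      P (Ideal.Quotient.mk (maxIdeal R ^ n) b ⊗ₜ D k A a)) (w) : P w := by
  induction w using TensorProduct.induction_on with
  | zero => exact zero
  | add a b ha hb => exact add _ _ ha hb
  | tmul b ω =>
    have hω : ω ∈ Submodule.span A (Set.range (D k A)) := by
      rw [KaehlerDifferential.span_range_derivation]; trivial
    induction hω using Submodule.span_induction generalizing b with
    | zero => rw [TensorProduct.tmul_zero]; exact zero
    | add a c _ _ ha hc => rw [TensorProduct.tmul_add]; exact add _ _ (ha b) (hc b)
    | smul a c _ hc => rw [← TensorProduct.smul_tmul]; exact hc _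
    | mem c hc =>
      obtain ⟨a, rfl⟩ := hc
      obtain ⟨b, rfl⟩ := Ideal.Quotient.mk_surjective b
      exact tmul b a

variable (k R A : Type u) [Field k] [CommRing R] [Algebra k R] [CommRing A] [Algebra k A]
  [Algebra A R⟦X⟧] [IsScalarTower k A R⟦X⟧]

/-- The derivation `a ↦ d(x(a))/dz` of `A`, for a jet `x : A → R[[z]]`. -/
def jetDerivation : Derivation k A R⟦X⟧ :=
  ((derivative R).restrictScalars k).compAlgebraMap A

theorem map_constantCoeff_span_range_jetDerivation :
    (Ideal.span (Set.range (jetDerivation k R A))).map constantCoeff =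
      jetIdeal (IsScalarTower.toAlgHom k A R⟦X⟧) := by
  rw [Ideal.map_span, ← Set.range_comp, jetIdeal]
  congr 2
  exact funext fun a => constantCoeff_derivative (algebraMap A R⟦X⟧ a)

/-- The map `R[z]/zⁿ ⊗_A Ω¹_A → R[z]/zⁿ`, `b ⊗ da ↦ b d(x(a))/dz`: the pullback of differentials
followed by `dz ↦ 1`. It loses no power of `z`, unlike `truncOmegaMap`. -/
def jetOmegaMap (n : ℕ) : TruncPS R n ⊗[A] Ω[A⁄k] →ₗ[TruncPS R n] TruncPS R n :=
  (((Ideal.Quotient.mkₐ A (maxIdeal R ^ n)).toLinearMap.compDer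
    (jetDerivation k R A)).liftKaehlerDifferential).liftBaseChange (TruncPS R n)

theorem jetOmegaMap_tmul_D (n : ℕ) (b : TruncPS R n) (a : A) :
    jetOmegaMap k R A n (b ⊗ₜ D k A a) = b * Ideal.Quotient.mk _ (jetDerivation k R A a) := by
  rw [jetOmegaMap, LinearMap.liftBaseChange_tmul, Derivation.liftKaehlerDifferential_comp_D]
  rfl

theorem range_jetOmegaMap (n : ℕ) : LinearMap.range (jetOmegaMap k R A n) =
    (Ideal.span (Set.range (jetDerivation k R A))).map (Ideal.Quotient.mk (maxIdeal R ^ n)) := by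
  rw [Ideal.map_span]
  apply le_antisymm
  · rintro _ ⟨w, rfl⟩
    induction w using tensorOmega_induction with
    | zero => exact map_zero (jetOmegaMap k R A n) ▸ Submodule.zero_mem _
    | add v w hv hw => exact map_add (jetOmegaMap k R A n) v w ▸ Submodule.add_mem _ hv hw
    | tmul b a =>
      rw [jetOmegaMap_tmul_D]
      exact Ideal.mul_mem_left _ _ (Ideal.subset_span ⟨_, ⟨a, rfl⟩, rfl⟩)
  · rw [Ideal.span_le]
    rintro _ ⟨_, ⟨a, rfl⟩, rfl⟩
    exact ⟨1 ⊗ₜ D k A a, by rw [jetOmegaMap_tmul_D, one_mul]⟩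

theorem factor_jetOmegaMap (n : ℕ) (w : TruncPS R (n + 1) ⊗[A] Ω[A⁄k]) :
    Ideal.Quotient.factor (Ideal.pow_le_pow_right n.le_succ :
      maxIdeal R ^ (n + 1) ≤ maxIdeal R ^ n) (jetOmegaMap k R A (n + 1) w) =
    jetOmegaMap k R A n (LinearMap.rTensor Ω[A⁄k]
      (Ideal.Quotient.factorₐ A (Ideal.pow_le_pow_right n.le_succ)).toLinearMap w) := by
  induction w using tensorOmega_induction with
  | zero => simp only [map_zero]
  | add v w hv hw => rw [map_add, map_add, hv, hw, map_add, map_add]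
  | tmul b a =>
    rw [jetOmegaMap_tmul_D, LinearMap.rTensor_tmul, jetOmegaMap_tmul_D, map_mul,
      Ideal.Quotient.factor_mk]
    rfl

theorem truncOmegaMap_pullbackMapTrunc (n : ℕ) (w : TruncPS R (n + 1) ⊗[A] Ω[A⁄k]) :
    truncOmegaMap R n (pullbackMapTrunc k R A (n + 1) w) =
    jetOmegaMap k R A n (LinearMap.rTensor Ω[A⁄k]
      (Ideal.Quotient.factorₐ A (Ideal.pow_le_pow_right n.le_succ)).toLinearMap w) := by
  induction w using tensorOmega_induction with
  | zero => simp only [map_zero]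
  | add v w hv hw => rw [map_add, map_add, hv, hw, map_add, map_add]
  | tmul b a =>
    rw [LinearMap.rTensor_tmul, jetOmegaMap_tmul_D, pullbackMapTrunc,
      LinearMap.liftBaseChange_tmul, KaehlerDifferential.map_D]
    exact truncOmegaMap_smul_D R n b _

variable {k R A}

theorem jetOmegaMap_surjective (h : jetIdeal (IsScalarTower.toAlgHom k A R⟦X⟧) = ⊤) (n : ℕ) :
    Function.Surjective (jetOmegaMap k R A n) := by
  rw [← map_constantCoeff_span_range_jetDerivation, Ideal.eq_top_iff_one,
    Ideal.mem_map_iff_of_surjective _ constantCoeff_surj] at h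
  obtain ⟨f, hf, hf1⟩ := h
  rw [← LinearMap.range_eq_top, range_jetOmegaMap, Ideal.eq_top_of_isUnit_mem _ hf
    (isUnit_iff_constantCoeff.2 (hf1 ▸ isUnit_one)), Ideal.map_top]

theorem jetIdeal_eq_top_of_pullbackMap_surjective
    (h : Function.Surjective (pullbackMap k R A)) :
    jetIdeal (IsScalarTower.toAlgHom k A R⟦X⟧) = ⊤ := by
  obtain ⟨w, hw⟩ := h (contOmegaDX R)
  have w_two : pullbackMapTrunc k R A 2 (w.1 2) = D R (TruncPS R 2) (Ideal.Quotient.mk _ X) :=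
    congrFun (congrArg Subtype.val hw) 2
  have w_one : jetOmegaMap k R A 1 (w.1 1) = Ideal.Quotient.mk _ 1 := by
    rw [← w.2 1, ← truncOmegaMap_pullbackMapTrunc, w_two, ← one_smul (TruncPS R 2) (D R _ _),
      ← map_one (Ideal.Quotient.mk _), truncOmegaMap_smul_D, derivative_X, mul_one]
  have one_mem : Ideal.Quotient.mk (maxIdeal R ^ 1) 1 ∈
      (Ideal.span (Set.range (jetDerivation k R A))).map (Ideal.Quotient.mk (maxIdeal R ^ 1)) :=
    range_jetOmegaMap k R A 1 ▸ ⟨w.1 1, w_one⟩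
  obtain ⟨f, hf, hf1⟩ := (Ideal.mem_map_iff_of_surjective _ Ideal.Quotient.mk_surjective).1 one_mem
  rw [Ideal.Quotient.eq, pow_one, mem_maxIdeal_iff, map_sub, map_one, sub_eq_zero] at hf1
  rw [← map_constantCoeff_span_range_jetDerivation, Ideal.eq_top_iff_one, ← hf1]
  exact Ideal.mem_map_of_mem _ hf

theorem pullbackMap_injective (h : ∀ n, Function.Injective (jetOmegaMap k R A n)) :
    Function.Injective (pullbackMap k R A) := by
  intro w w' hww
  refine Subtype.ext (funext fun n => h n ?_)
  rw [← w.2 n, ← w'.2 n, ← truncOmegaMap_pullbackMapTrunc, ← truncOmegaMap_pullbackMapTrunc]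
  exact congrArg (truncOmegaMap R n) (congrFun (congrArg Subtype.val hww) (n + 1))

theorem pullbackMap_surjective [CharZero k] (h : ∀ n, Function.Bijective (jetOmegaMap k R A n)) :
    Function.Surjective (pullbackMap k R A) := by
  intro η
  choose w hw using fun n => (h n).2 (truncOmegaMap R n (η.1 (n + 1)))
  have compatible (n : ℕ) : LinearMap.rTensor Ω[A⁄k] (Ideal.Quotient.factorₐ A
      (Ideal.pow_le_pow_right n.le_succ)).toLinearMap (w (n + 1)) = w n := by
    apply (h n).1
    rw [← factor_jetOmegaMap, hw, hw, factor_truncOmegaMap, η.2]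
  refine ⟨⟨w, compatible⟩, Subtype.ext (funext fun n => ?_)⟩
  change pullbackMapTrunc k R A n (w n) = η.1 n
  cases n with
  | zero =>
    have : Subsingleton (TruncPS R 0) :=
      Ideal.Quotient.subsingleton_iff.2 (by rw [pow_zero, Ideal.one_eq_top])
    have := Module.subsingleton (TruncPS R 0) Ω[TruncPS R 0⁄R]
    exact Subsingleton.elim _ _
  | succ n =>
    apply truncOmegaMap_injective R k
    rw [truncOmegaMap_pullbackMapTrunc, compatible, hw]

end PullbackOmega

theorem isIsoOnOmega_iff {k R A : Type u} [Field k] [CharZero k] [CommRing R] [Algebra k R]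
    [CommRing A] [Algebra k A] (hA : LocallyCyclic A Ω[A⁄k]) (φ : A →ₐ[k] R⟦X⟧) :
    IsIsoOnOmega φ ↔ jetIdeal φ = ⊤ := by
  algebraize [φ.toRingHom]
  have : IsScalarTower k A R⟦X⟧ := IsScalarTower.of_algebraMap_eq fun c => (φ.commutes c).symm
  refine ⟨fun h => jetIdeal_eq_top_of_pullbackMap_surjective h.2, fun h => ?_⟩
  have bijective (n : ℕ) : Function.Bijective (jetOmegaMap k R A n) :=
    (hA.baseChange (TruncPS R n)).bijective_of_surjective (jetOmegaMap_surjective h n)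
  exact ⟨pullbackMap_injective fun n => (bijective n).1, pullbackMap_surjective bijective⟩

/-! ### Coordinates on smooth affine curves -/

section SmoothCurve

variable {k A : Type u} [Field k] [CommRing A] [Algebra k A]

theorem exists_isCoordinate_of_isStandardSmooth
    [h : Algebra.IsStandardSmoothOfRelativeDimension 1 k A] :
    ∃ t : A, IsCoordinate k t ∧ ∀ a : A, a • D k A t = 0 → a = 0 := by
  classical
  obtain ⟨ι, σ, _, _, P, hP⟩ := h
  -- The one variable that is not paired with a relation is a basis of `Ω¹`.
  have card_free : Nat.card ((Set.range P.map)ᶜ : Set ι) = 1 := by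
    have h := Nat.card_congr (Equiv.Set.sumCompl (Set.range P.map))
    rw [Nat.card_sum, Nat.card_range_of_injective P.map_inj] at h
    rw [Algebra.Presentation.dimension] at hP
    omega
  obtain ⟨i, hi⟩ := Nat.card_eq_one_iff_exists.1 card_free
  refine ⟨P.val i, ?_, fun a ha => ?_⟩
  · rw [IsCoordinate, eq_top_iff, ← P.basisKaehler.span_eq, Submodule.span_le]
    rintro _ ⟨i', rfl⟩
    rw [hi i', P.basisKaehler_apply]
    exact Submodule.mem_span_singleton_self _
  · rw [← P.basisKaehler_apply] at ha
    simpa only [map_smul, Finsupp.smul_apply, Module.Basis.repr_self, Finsupp.single_eq_same,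
      smul_eq_mul, mul_one, map_zero, Finsupp.zero_apply]
      using congrArg (fun ω => P.basisKaehler.repr ω i) ha

/-- The algebra `A` is smooth of relative dimension one over `k`. -/
abbrev IsSmoothCurve (k A : Type u) [Field k] [CommRing A] [Algebra k A] : Prop :=
  RingHom.Locally (RingHom.IsStandardSmoothOfRelativeDimension 1) (algebraMap k A)

theorem IsSmoothCurve.exists_span_eq_top (h : IsSmoothCurve k A) :
    ∃ s : Set A, Ideal.span s = ⊤ ∧ ∀ g ∈ s, ∃ t : Localization.Away g, IsCoordinate k t ∧
      ∀ a : Localization.Away g, a • D k (Localization.Away g) t = 0 → a = 0 := by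
  obtain ⟨s, hs, h⟩ := h
  refine ⟨s, hs, fun g hg => ?_⟩
  have smooth := h g hg
  rw [← IsScalarTower.algebraMap_eq,
    RingHom.isStandardSmoothOfRelativeDimension_algebraMap] at smooth
  exact exists_isCoordinate_of_isStandardSmooth

theorem exists_forall_pow_smul_eq_smul {A B M N : Type*} [CommRing A] [CommRing B] [Algebra A B]
    [AddCommGroup M] [Module A M] [AddCommGroup N] [Module A N] [Module B N] [IsScalarTower A B N]
    (g : A) [IsLocalization.Away g B] (f : M →ₗ[A] N)
    [IsLocalizedModule (Submonoid.powers g) f] {x : N} (hx : Submodule.span B {x} = ⊤) :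
    ∃ e : M, ∀ m : M, ∃ (n : ℕ) (a : A), g ^ n • m = a • e := by
  obtain ⟨⟨e, ⟨_, n, rfl⟩⟩, he : g ^ n • x = f e⟩ :=
    IsLocalizedModule.surj (Submonoid.powers g) f x
  refine ⟨e, fun m => ?_⟩
  obtain ⟨c, hc⟩ := Submodule.mem_span_singleton.1 (hx ▸ Submodule.mem_top : f m ∈ _)
  obtain ⟨⟨a, ⟨_, l, rfl⟩⟩, ha : c * algebraMap A B (g ^ l) = algebraMap A B a⟩ :=
    IsLocalization.surj (Submonoid.powers g) c
  have apply_eq : f (g ^ (l + n) • m) = f (a • e) := by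
    rw [map_smul, map_smul, ← hc, ← he, ← algebraMap_smul B a, ← ha, pow_add, mul_smul,
      smul_comm (g ^ n) c, ← algebraMap_smul B (g ^ l) (c • _), smul_smul, mul_comm]
  obtain ⟨⟨_, q, rfl⟩, hq : g ^ q • g ^ (l + n) • m = g ^ q • a • e⟩ :=
    (IsLocalizedModule.eq_iff_exists (Submonoid.powers g) f).1 apply_eq
  exact ⟨q + (l + n), g ^ q * a, by rw [pow_add, mul_smul, hq, mul_smul]⟩

theorem IsSmoothCurve.locallyCyclic (h : IsSmoothCurve k A) : LocallyCyclic A Ω[A⁄k] := by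
  obtain ⟨s, hs, h⟩ := h.exists_span_eq_top
  refine ⟨s, hs, fun g hg => ?_⟩
  obtain ⟨t, ht, -⟩ := h g hg
  have := KaehlerDifferential.isLocalizedModule_map k A (Localization.Away g) (Submonoid.powers g)
  exact exists_forall_pow_smul_eq_smul g (KaehlerDifferential.map k k A (Localization.Away g)) ht

theorem IsCoordinate.localizationAway {t : A} (ht : IsCoordinate k t) (g : A) :
    IsCoordinate k (algebraMap A (Localization.Away g) t) := by
  rw [IsCoordinate, eq_top_iff, ← KaehlerDifferential.span_range_map_derivation_of_isLocalization
    k A (Localization.Away g) (Submonoid.powers g), Submodule.span_le]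
  rintro _ ⟨a, rfl⟩
  obtain ⟨c, hc⟩ := Submodule.mem_span_singleton.1 (ht ▸ Submodule.mem_top : D k A a ∈ _)
  rw [Function.comp_apply, ← hc, map_smul, KaehlerDifferential.map_D,
    ← algebraMap_smul (Localization.Away g)]
  exact Submodule.smul_mem _ _ (Submodule.mem_span_singleton_self _)

theorem IsCoordinate.smul_D_eq_zero (hA : IsSmoothCurve k A) {t : A} (ht : IsCoordinate k t)
    {a : A} (ha : a • D k A t = 0) : a = 0 := by
  obtain ⟨s, hs, h⟩ := hA.exists_span_eq_top
  refine Localization.algebraMap_injective_of_span_eq_top s hs (funext fun ⟨g, hg⟩ => ?_)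
  obtain ⟨t', -, smul_eq_zero⟩ := h g hg
  let B := Localization.Away g
  change algebraMap A B a = algebraMap A B 0
  obtain ⟨c, hc⟩ := Submodule.mem_span_singleton.1
    (ht.localizationAway g ▸ Submodule.mem_top : D k B t' ∈ _)
  have apply_eq_zero := congrArg (KaehlerDifferential.map k k A B) ha
  rw [map_smul, map_zero, KaehlerDifferential.map_D, ← algebraMap_smul B] at apply_eq_zero
  rw [map_zero]
  exact smul_eq_zero _ (by rw [← hc, smul_comm, apply_eq_zero, smul_zero])

theorem IsCoordinate.exists_derivation (hA : IsSmoothCurve k A) {t : A} (ht : IsCoordinate k t) :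
    ∃ d : Derivation k A A, d t = 1 := by
  let e := LinearEquiv.ofBijective (LinearMap.toSpanSingleton A Ω[A⁄k] (D k A t))
    ⟨(injective_iff_map_eq_zero _).2 fun _ => ht.smul_D_eq_zero hA,
      LinearMap.range_eq_top.1 ((LinearMap.range_toSpanSingleton _).trans ht)⟩
  exact ⟨e.symm.toLinearMap.compDer (D k A), e.symm_apply_eq.2 (one_smul A _).symm⟩

end SmoothCurve

/-! ### Points and jets in affine charts -/

section Charts

variable {k : Type u} [Field k] {C : Scheme.{u}} {p : C ⟶ Spec (CommRingCat.of k)}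
  {R S T A B : Type u} [CommRing R] [Algebra k R] [CommRing S] [Algebra k S] [CommRing T]
  [Algebra k T] [CommRing A] [Algebra k A] [CommRing B] [Algebra k B]

theorem comp_eq_comp_iff_exists_lift {𝒞 : Type*} [Category* 𝒞] [Limits.HasPullbacks 𝒞]
    {X Y Z W : 𝒞} {p : X ⟶ Z} {y y' : Y ⟶ X} (h : y ≫ p = y' ≫ p) (f : W ⟶ Y) : f ≫ y = f ≫ y' ↔
      ∃ l, l ≫ Limits.pullback.snd (Limits.pullback.diagonal p) (Limits.pullback.lift y y' h) =
        f := by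
  have condition := Limits.pullback.condition (f := Limits.pullback.diagonal p)
    (g := Limits.pullback.lift y y' h)
  refine ⟨fun hf => ⟨Limits.pullback.lift (f ≫ y) f ?_, Limits.pullback.lift_snd ..⟩, ?_⟩
  · apply Limits.pullback.hom_ext
    · simp only [Category.assoc, Limits.pullback.diagonal_fst, Limits.pullback.lift_fst,
        Category.comp_id]
    · simpa only [Category.assoc, Limits.pullback.diagonal_snd, Limits.pullback.lift_snd,
        Category.comp_id] using hf
  · rintro ⟨l, rfl⟩
    have h₁ := congrArg (· ≫ Limits.pullback.fst p p) condition
    have h₂ := congrArg (· ≫ Limits.pullback.snd p p) condition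
    simp only [Category.assoc, Limits.pullback.diagonal_fst, Limits.pullback.diagonal_snd,
      Limits.pullback.lift_fst, Limits.pullback.lift_snd, Category.comp_id] at h₁ h₂
    rw [Category.assoc, Category.assoc, ← h₁, ← h₂]

namespace Pt

theorem map_id (x : Pt p R) : map (AlgHom.id k R) x = x := by
  apply Subtype.ext
  change Spec.map (𝟙 _) ≫ x.1 = x.1
  rw [Spec.map_id, Category.id_comp]

theorem map_map (f : R →ₐ[k] S) (g : S →ₐ[k] T) (x : Pt p R) :
    map g (map f x) = map (g.comp f) x := by
  apply Subtype.ext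
  change Spec.map _ ≫ Spec.map _ ≫ x.1 = Spec.map _ ≫ x.1
  rw [← Category.assoc, ← Spec.map_comp]
  rfl

theorem map_injective (j : Pt p A) [Mono j.1] {φ ψ : A →ₐ[k] R} (h : map φ j = map ψ j) :
    φ = ψ := by
  have hom_eq := Spec.map_injective ((cancel_mono j.1).1 (congrArg Subtype.val h))
  ext a
  exact congrArg (fun f => f.hom a) hom_eq

theorem exists_eq_map (j : Pt p A) [IsOpenImmersion j.1] (y : Pt p R)
    (h : Set.range y.1 ⊆ Set.range j.1) : ∃ φ : A →ₐ[k] R, y = map φ j := by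
  obtain ⟨f, hf⟩ := Spec.map_surjective (IsOpenImmersion.lift j.1 y.1 h)
  have fac : Spec.map f ≫ j.1 = y.1 := by rw [hf, IsOpenImmersion.lift_fac]
  have over_k : CommRingCat.ofHom (algebraMap k A) ≫ f = CommRingCat.ofHom (algebraMap k R) :=
    Spec.map_injective (by rw [Spec.map_comp, ← j.2, ← y.2, ← Category.assoc, fac])
  exact ⟨{ f.hom with commutes' := fun c => congrArg (fun g => g.hom c) over_k },
    Subtype.ext fac.symm⟩

theorem range_map_subset (f : R →ₐ[k] S) (x : Pt p R) : Set.range (map f x).1 ⊆ Set.range x.1 := by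
  rintro _ ⟨q, rfl⟩
  exact ⟨Spec.map (CommRingCat.ofHom f.toRingHom) q, rfl⟩

theorem apply_comap_mem (f : R →ₐ[k] S) (x : Pt p R) (q : PrimeSpectrum S) {Z : Set C}
    (h : Set.range (map f x).1 ⊆ Z) : x.1 (PrimeSpectrum.comap f.toRingHom q) ∈ Z :=
  h ⟨q, rfl⟩

theorem exists_notMem_forall_apply_mem (x : Pt p R) (q : PrimeSpectrum R) (U : C.Opens)
    (h : x.1 q ∈ U) : ∃ f ∉ q.asIdeal, ∀ q' : PrimeSpectrum R, f ∉ q'.asIdeal → x.1 q' ∈ U := by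
  let V : TopologicalSpace.Opens (PrimeSpectrum R) := x.1 ⁻¹ᵁ U
  obtain ⟨_, ⟨f, rfl⟩, hq, hf⟩ :=
    PrimeSpectrum.isTopologicalBasis_basic_opens.exists_subset_of_mem_open
      (show q ∈ (V : Set (PrimeSpectrum R)) from h) V.isOpen
  exact ⟨f, hq, fun _ hq' => hf hq'⟩

theorem range_map_subset_of_isUnit (x : Pt p R) {f : R} {Z : Set C}
    (h : ∀ q : PrimeSpectrum R, f ∉ q.asIdeal → x.1 q ∈ Z) (g : R →ₐ[k] S) (hg : IsUnit (g f)) :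
    Set.range (map g x).1 ⊆ Z := by
  rintro _ ⟨q, rfl⟩
  exact h (PrimeSpectrum.comap g.toRingHom q) fun mem =>
    q.isPrime.ne_top (Ideal.eq_top_of_isUnit_mem _ mem hg)

theorem isSmoothCurve [SmoothOfRelativeDimension 1 p] (j : Pt p A) [IsOpenImmersion j.1] :
    IsSmoothCurve k A := by
  have smooth : SmoothOfRelativeDimension (0 + 1) (j.1 ≫ p) := inferInstance
  rw [j.2] at smooth
  exact (HasRingHomProperty.Spec_iff (P := @SmoothOfRelativeDimension 1)).1 smooth

theorem isOpenImmersion_map_away (j : Pt p A) [IsOpenImmersion j.1] (g : A) :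
    IsOpenImmersion (map (IsScalarTower.toAlgHom k A (Localization.Away g)) j).1 := by
  have : IsOpenImmersion (Spec.map (CommRingCat.ofHom (algebraMap A (Localization.Away g)))) :=
    inferInstance
  exact inferInstanceAs (IsOpenImmersion
    (Spec.map (CommRingCat.ofHom (algebraMap A (Localization.Away g))) ≫ j.1))

theorem apply_mem_range_map_away (j : Pt p A) {g : A} {q : PrimeSpectrum A} (hg : g ∉ q.asIdeal) :
    j.1 q ∈ Set.range (map (IsScalarTower.toAlgHom k A (Localization.Away g)) j).1 := by
  have mem_range : q ∈ Set.range (PrimeSpectrum.comap (algebraMap A (Localization.Away g))) := by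
    rw [PrimeSpectrum.localization_away_comap_range (Localization.Away g) g]
    exact hg
  obtain ⟨q', rfl⟩ := mem_range
  exact ⟨q', rfl⟩

theorem exists_ideal_forall_map_eq_iff [IsSeparated p] (y y' : Pt p R) :
    ∃ I : Ideal R, ∀ (S : Type u) [CommRing S] [Algebra k S] (f : R →ₐ[k] S),
      map f y = map f y' ↔ I ≤ RingHom.ker f := by
  have agree : y.1 ≫ p = y'.1 ≫ p := y.2.trans y'.2.symm
  have closed : IsClosedImmersion (Limits.pullback.snd (Limits.pullback.diagonal p)
    (Limits.pullback.lift y.1 y'.1 agree)) := inferInstance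
  obtain ⟨I, e, he⟩ := IsClosedImmersion.Spec_iff.1 closed
  refine ⟨I, fun S _ _ f => ?_⟩
  refine Subtype.ext_iff.trans <| (comp_eq_comp_iff_exists_lift agree
    (Spec.map (CommRingCat.ofHom f.toRingHom))).trans ?_
  rw [he]
  refine ⟨?_, fun hI => ?_⟩
  · rintro ⟨l, hl⟩ r hr
    obtain ⟨q, hq⟩ := Spec.map_surjective (l ≫ e.hom)
    rw [← Category.assoc, ← hq, ← Spec.map_comp] at hl
    calc f r = q.hom (Ideal.Quotient.mk I r) :=
          (congrArg (fun g => g.hom r) (Spec.map_injective hl)).symm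
      _ = 0 := by rw [Ideal.Quotient.eq_zero_iff_mem.2 hr, map_zero]
  · refine ⟨Spec.map (CommRingCat.ofHom (Ideal.Quotient.lift I f.toRingHom hI)) ≫ e.inv, ?_⟩
    rw [Category.assoc, e.inv_hom_id_assoc, ← Spec.map_comp]
    rfl

theorem ext_of_jointly_injective [IsSeparated p] {ι : Type u} {S : ι → Type u}
    [∀ i, CommRing (S i)] [∀ i, Algebra k (S i)] (f : ∀ i, R →ₐ[k] S i)
    (hf : ∀ r, (∀ i, f i r = 0) → r = 0) {y y' : Pt p R}
    (h : ∀ i, map (f i) y = map (f i) y') : y = y' := by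
  obtain ⟨I, hI⟩ := exists_ideal_forall_map_eq_iff y y'
  rw [← map_id y, ← map_id y', hI]
  exact fun r hr => hf r fun i => (hI _ (f i)).1 (h i) hr

end Pt

theorem exists_pt_range_eq (p : C ⟶ Spec (CommRingCat.of k)) {U : C.Opens}
    (hU : IsAffineOpen U) : ∃ (A : Type u) (_ : CommRing A) (_ : Algebra k A) (j : Pt p A),
      IsOpenImmersion j.1 ∧ Set.range j.1 = U := by
  let := (Spec.preimage (hU.fromSpec ≫ p)).hom.toAlgebra
  exact ⟨Γ(C, U), inferInstance, this, ⟨hU.fromSpec, (Spec.map_preimage _).symm⟩,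
    inferInstanceAs (IsOpenImmersion hU.fromSpec), hU.range_fromSpec⟩

theorem exists_coordinate_chart (p : C ⟶ Spec (CommRingCat.of k)) [SmoothOfRelativeDimension 1 p]
    (c : C) : ∃ (A : Type u) (_ : CommRing A) (_ : Algebra k A) (j : Pt p A),
      IsOpenImmersion j.1 ∧ c ∈ Set.range j.1 ∧ ∃ t : A, IsCoordinate k t := by
  obtain ⟨U, hU, hc, -⟩ := exists_isAffineOpen_mem_and_subset (x := c) (U := ⊤) trivial
  obtain ⟨A, _, _, j, _, hj⟩ := exists_pt_range_eq p hU
  obtain ⟨q, rfl⟩ : c ∈ Set.range j.1 := hj ▸ hc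
  obtain ⟨s, hs, local_coordinate⟩ := j.isSmoothCurve.exists_span_eq_top
  obtain ⟨g, hg, hgq⟩ : ∃ g ∈ s, g ∉ q.asIdeal := by
    by_contra! hcon
    exact q.isPrime.ne_top (top_le_iff.1 (hs ▸ Ideal.span_le.2 hcon))
  obtain ⟨t, ht, -⟩ := local_coordinate g hg
  exact ⟨Localization.Away g, inferInstance, inferInstance, _, j.isOpenImmersion_map_away g,
    j.apply_mem_range_map_away hgq, t, ht⟩

theorem X_mem_of_isMaximal (m : Ideal R⟦X⟧) [hm : m.IsMaximal] : X ∈ m := by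
  have mem_jacobson : (X : R⟦X⟧) ∈ Ideal.jacobson ⊥ :=
    Ideal.mem_jacobson_bot.2 fun f => isUnit_iff_constantCoeff.2 (by simp)
  exact Ideal.mem_sInf.1 mem_jacobson ⟨bot_le, hm⟩

theorem exists_constantCoeff_comap_eq (m : PrimeSpectrum R⟦X⟧) (hm : X ∈ m.asIdeal) :
    ∃ q, PrimeSpectrum.comap (constantCoeff : R⟦X⟧ →+* R) q = m := by
  change m ∈ Set.range _
  rw [range_comap_of_surjective _ _ constantCoeff_surj]
  intro f hf
  obtain ⟨g, rfl⟩ := X_dvd_iff.2 hf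
  exact Ideal.mul_mem_right _ _ hm

namespace Jet

-- Every point of `Spec R[[z]]` specializes to a point of the closed subscheme `Spec R`.
theorem range_subset (y : Jet p R) (U : C.Opens) (h : Set.range y.base.1 ⊆ U) :
    Set.range y.1 ⊆ U := by
  rintro _ ⟨q, rfl⟩
  obtain ⟨m, hm, hqm⟩ := Ideal.exists_le_maximal q.asIdeal q.isPrime.ne_top
  obtain ⟨r, hr⟩ := exists_constantCoeff_comap_eq ⟨m, hm.isPrime⟩ (X_mem_of_isMaximal m)
  have mem_U : y.1 ⟨m, hm.isPrime⟩ ∈ U := h ⟨r, by rw [← hr]; rfl⟩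
  have specializes : (q : PrimeSpectrum R⟦X⟧) ⤳ ⟨m, hm.isPrime⟩ :=
    (PrimeSpectrum.le_iff_specializes _ _).1 hqm
  exact (specializes.map y.1.continuous).mem_open U.isOpen mem_U

theorem exists_eq_map (j : Pt p A) [IsOpenImmersion j.1] (y : Jet p R)
    (h : Set.range y.base.1 ⊆ Set.range j.1) : ∃ φ : A →ₐ[k] R⟦X⟧, y = Pt.map φ j :=
  Pt.exists_eq_map j y (range_subset y j.1.opensRange h)

theorem base_map (f : R →ₐ[k] S) (y : Jet p R) : (map f y).base = Pt.map f y.base := by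
  rw [base, base, map, Pt.map_map, Pt.map_map]
  rfl

theorem map_map (f : R →ₐ[k] S) (g : S →ₐ[k] T) (y : Jet p R) :
    map g (map f y) = map (g.comp f) y := by
  rw [map, map, Pt.map_map]
  rfl

theorem map_pt_map (f : R →ₐ[k] S) (φ : A →ₐ[k] R⟦X⟧) (j : Pt p A) :
    map f (Pt.map φ j) = Pt.map ((PowerSeries.mapAlgHom f).comp φ) j :=
  Pt.map_map _ _ _

theorem smul_pt_map (ρ : AutPlus R) (φ : A →ₐ[k] R⟦X⟧) (j : Pt p A) :
    ρ • (Pt.map φ j : Jet p R) = Pt.map ((ρ.1.toAlgHom.restrictScalars k).comp φ) j :=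
  Pt.map_map _ _ _

theorem map_smul (f : R →ₐ[k] S) (ρ : AutPlus R) (y : Jet p R) :
    map f (ρ • y) = AutPlus.map f.toRingHom ρ • map f y := by
  change Pt.map _ (Pt.map _ y) = Pt.map _ (Pt.map _ y)
  rw [Pt.map_map, Pt.map_map]
  congr 1
  ext1 g
  exact (AutPlus.map_apply_map f.toRingHom ρ g).symm

theorem base_smul (ρ : AutPlus R) (y : Jet p R) : (ρ • y).base = y.base := by
  change Pt.map _ (Pt.map _ y) = Pt.map _ y
  rw [Pt.map_map]
  congr 1
  ext1 g
  exact AutPlus.constantCoeff_apply ρ g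

theorem base_pt_map_eq_iff (j : Pt p A) [Mono j.1] (φ : A →ₐ[k] R⟦X⟧) (x : A →ₐ[k] R) :
    base (Pt.map φ j) = Pt.map x j ↔ ∀ a, constantCoeff (φ a) = x a := by
  rw [base, Pt.map_map]
  refine ⟨fun h a => ?_, fun h => ?_⟩
  · exact congrArg (fun f => f a) (Pt.map_injective j h)
  · congr 1
    ext a
    exact h a

theorem ext_of_jointly_injective [IsSeparated p] {ι : Type u} {S : ι → Type u}
    [∀ i, CommRing (S i)] [∀ i, Algebra k (S i)] (f : ∀ i, R →ₐ[k] S i)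
    (hf : ∀ r, (∀ i, f i r = 0) → r = 0) {y y' : Jet p R}
    (h : ∀ i, map (f i) y = map (f i) y') : y = y' := by
  refine Pt.ext_of_jointly_injective (fun i => PowerSeries.mapAlgHom (f i)) (fun g hg => ?_) h
  ext n
  refine (hf _ fun i => ?_).trans (map_zero _).symm
  exact (coeff_map (f i : R →+* S i) n g).symm.trans (congrArg (coeff n) (hg i))

end Jet

theorem jetIdeal_eq_of_range_subset (e : Pt p B) [IsOpenImmersion e.1] (i : Pt p A)
    [IsOpenImmersion i.1] (h : Set.range e.1 ⊆ Set.range i.1) {φ : A →ₐ[k] R⟦X⟧}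
    {χ : B →ₐ[k] R⟦X⟧} (hφ : Pt.map φ i = Pt.map χ e) : jetIdeal φ = jetIdeal χ := by
  obtain ⟨ι, rfl⟩ := Pt.exists_eq_map i e h
  rw [Pt.map_map] at hφ
  rw [Pt.map_injective i hφ]
  have openImmersion_comp : IsOpenImmersion (Spec.map (CommRingCat.ofHom ι.toRingHom) ≫ i.1) :=
    ‹IsOpenImmersion (Pt.map ι i).1›
  have openImmersion : IsOpenImmersion (Spec.map (CommRingCat.ofHom ι.toRingHom)) :=
    IsOpenImmersion.of_comp _ i.1
  exact jetIdeal_comp ι ((HasRingHomProperty.Spec_iff (P := @FormallyUnramified)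
    (φ := CommRingCat.ofHom ι.toRingHom)).1 inferInstance) χ

theorem exists_chart_inter [IsSeparated p] (j : Pt p A) [IsOpenImmersion j.1] (j' : Pt p B)
    [IsOpenImmersion j'.1] : ∃ (E : Type u) (_ : CommRing E) (_ : Algebra k E) (e : Pt p E),
      IsOpenImmersion e.1 ∧ Set.range e.1 = Set.range j.1 ∩ Set.range j'.1 := by
  have : IsAffineHom (Limits.pullback.diagonal p) := inferInstance
  have affine_inter : IsAffineOpen (j.1.opensRange ⊓ j'.1.opensRange) :=
    isAffineHom_diagonal_iff.1 this ⊤ (isAffineOpen_top _) _ (by simp) _ (by simp)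
      (isAffineOpen_opensRange _) (isAffineOpen_opensRange _)
  exact exists_pt_range_eq p affine_inter

theorem jetIdeal_eq_of_pt_map_eq [IsSeparated p] (j : Pt p A) [IsOpenImmersion j.1] (j' : Pt p B)
    [IsOpenImmersion j'.1] {φ : A →ₐ[k] R⟦X⟧} {φ' : B →ₐ[k] R⟦X⟧}
    (h : Pt.map φ j = Pt.map φ' j') : jetIdeal φ = jetIdeal φ' := by
  obtain ⟨E, _, _, e, _, he⟩ := exists_chart_inter j j'
  obtain ⟨χ, hχ⟩ := Pt.exists_eq_map e (Pt.map φ j) <| he ▸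
    Set.subset_inter (Pt.range_map_subset _ _) (h ▸ Pt.range_map_subset _ _)
  rw [jetIdeal_eq_of_range_subset e j (he ▸ Set.inter_subset_left) hχ,
    jetIdeal_eq_of_range_subset e j' (he ▸ Set.inter_subset_right) (h.symm.trans hχ)]

end Charts

/-! ### The torsor `Aut_C` -/

section AutC

variable {k : Type u} [Field k] {C : Scheme.{u}} {p : C ⟶ Spec (CommRingCat.of k)}
  {R S A : Type u} [CommRing R] [Algebra k R] [CommRing S] [Algebra k S] [CommRing A] [Algebra k A]

section Criterion

variable [CharZero k] [SmoothOfRelativeDimension 1 p]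

theorem jetIdeal_eq_top_of_field {K : Type u} [Field K] [Algebra k K] {y : Jet p R}
    (hy : y ∈ AutC p R) (f : R →ₐ[k] K) (j : Pt p A) [IsOpenImmersion j.1] {φ : A →ₐ[k] K⟦X⟧}
    (hφ : Jet.map f y = Pt.map φ j) : jetIdeal φ = ⊤ := by
  let q : PrimeSpectrum R := PrimeSpectrum.comap f.toRingHom ⊥
  have mem_chart : y.base.1 q ∈ j.1.opensRange := by
    refine Pt.apply_comap_mem f y.base ⊥ ?_
    rw [← Jet.base_map, hφ, Jet.base, Pt.map_map]
    exact Pt.range_map_subset _ _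
  obtain ⟨g, hg, apply_mem⟩ := Pt.exists_notMem_forall_apply_mem y.base q j.1.opensRange mem_chart
  let π : R →ₐ[k] Localization.Away g := IsScalarTower.toAlgHom k R (Localization.Away g)
  obtain ⟨χ, hχ⟩ := Jet.exists_eq_map j (Jet.map π y) <| by
    rw [Jet.base_map]
    exact Pt.range_map_subset_of_isUnit y.base apply_mem π (IsLocalization.Away.algebraMap_isUnit g)
  have isUnit_apply : ∀ r : Submonoid.powers g, IsUnit (f r) := by
    rintro ⟨_, n, rfl⟩
    rw [map_pow]
    exact (Ne.isUnit hg).pow n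
  let e : Localization.Away g →ₐ[k] K := IsLocalization.liftAlgHom isUnit_apply
  have e_comp : e.comp π = f := AlgHom.ext fun r => IsLocalization.lift_eq _ r
  have map_eq : (PowerSeries.mapAlgHom e).comp χ = φ := Pt.map_injective j <| by
    rw [← Jet.map_pt_map, ← hχ, Jet.map_map, e_comp, hφ]
  rw [← map_eq, jetIdeal_map, (isIsoOnOmega_iff j.isSmoothCurve.locallyCyclic χ).1
    (hy A j g χ hχ), Ideal.map_top]

theorem jetIdeal_eq_top_of_mem_autC {y : Jet p R} (hy : y ∈ AutC p R) (f : R →ₐ[k] S)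
    (j : Pt p A) [IsOpenImmersion j.1] {φ : A →ₐ[k] S⟦X⟧} (hφ : Jet.map f y = Pt.map φ j) :
    jetIdeal φ = ⊤ := by
  by_contra hne
  obtain ⟨m, hm, hle⟩ := Ideal.exists_le_maximal _ hne
  let _ : Field (S ⧸ m) := Ideal.Quotient.field m
  let π : S →ₐ[k] S ⧸ m := Ideal.Quotient.mkₐ k m
  have map_eq_top : (jetIdeal φ).map π = ⊤ := by
    rw [← jetIdeal_map]
    refine jetIdeal_eq_top_of_field hy (π.comp f) j ?_
    rw [← Jet.map_map, hφ, Jet.map_pt_map]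
  have map_eq_bot : (jetIdeal φ).map π = ⊥ :=
    le_bot_iff.1 (Ideal.map_le_iff_le_comap.2 fun r hr => Ideal.Quotient.eq_zero_iff_mem.2 (hle hr))
  exact bot_ne_top (map_eq_bot.symm.trans map_eq_top)

theorem map_mem_autC (f : R →ₐ[k] S) {y : Jet p R} (hy : y ∈ AutC p R) :
    Jet.map f y ∈ AutC p S := by
  intro A _ _ j _ g φ hφ
  rw [Jet.map_map] at hφ
  exact (isIsoOnOmega_iff j.isSmoothCurve.locallyCyclic φ).2
    (jetIdeal_eq_top_of_mem_autC hy _ j hφ)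

theorem smul_mem_autC (ρ : AutPlus R) {y : Jet p R} (hy : y ∈ AutC p R) : ρ • y ∈ AutC p R := by
  intro A _ _ j _ g φ hφ
  rw [Jet.map_smul, eq_comm, ← inv_smul_eq_iff, Jet.smul_pt_map] at hφ
  exact (isIsoOnOmega_iff j.isSmoothCurve.locallyCyclic φ).2 <| top_le_iff.1 <|
    (jetIdeal_eq_top_of_mem_autC hy _ j hφ.symm).ge.trans (jetIdeal_smul_le _ φ)

theorem pt_map_mem_autC_iff [IsSeparated p] (j : Pt p A) [IsOpenImmersion j.1]
    (φ : A →ₐ[k] R⟦X⟧) : Pt.map φ j ∈ AutC p R ↔ jetIdeal φ = ⊤ := by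
  refine ⟨fun h => ?_, fun h B _ _ j' _ g φ' hφ' => ?_⟩
  · have map_eq_top := jetIdeal_eq_top_of_mem_autC h (AlgHom.id k R) j (Jet.map_pt_map _ φ j)
    rw [jetIdeal_map] at map_eq_top
    exact (Ideal.map_id _).symm.trans map_eq_top
  · rw [Jet.map_pt_map] at hφ'
    rw [isIsoOnOmega_iff j'.isSmoothCurve.locallyCyclic, ← jetIdeal_eq_of_pt_map_eq j j' hφ',
      jetIdeal_map, h, Ideal.map_top]

end Criterion

namespace FormalIso

theorem toJet_act (j : Pt p A) {x : A →ₐ[k] R} (ρ : AutPlus R) (φ : FormalIso x) :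
    (act ρ φ).toJet j = ρ • φ.toJet j :=
  (Jet.smul_pt_map ρ φ.toHom j).symm

theorem act_injective {x : A →ₐ[k] R} (φ : FormalIso x) :
    Function.Injective fun ρ : AutPlus R => act ρ φ := fun ρ ρ' h =>
  Subtype.ext <| AlgEquiv.ext fun g => by
    simpa only [act, AlgEquiv.trans_apply, AlgEquiv.apply_symm_apply]
      using congrArg (fun ψ : FormalIso x => ψ.1 (φ.1.symm g)) h

theorem toJet_injective (j : Pt p A) [IsOpenImmersion j.1] {t : A} {x : A →ₐ[k] R}
    {ψ : FormalIso x} (hψ : ψ.IsRho t) :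
    Function.Injective fun φ : FormalIso x => φ.toJet j := fun _ _ h =>
  ext_coordinate hψ (congrArg (fun f => f t) (Pt.map_injective j h))

end FormalIso

variable [CharZero k] [SmoothOfRelativeDimension 1 p] [IsSeparated p]

theorem bijOn_toJet (j : Pt p A) [IsOpenImmersion j.1] {t : A} (ht : IsCoordinate k t)
    (x : A →ₐ[k] R) : Set.BijOn (fun φ : FormalIso x => φ.toJet j) Set.univ
      {y | y ∈ AutC p R ∧ y.base = Pt.map x j} := by
  obtain ⟨d, hd⟩ := ht.exists_derivation j.isSmoothCurve
  obtain ⟨ψ, hψ, -⟩ := FormalIso.existsUnique_isRho ht hd x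
  refine ⟨fun φ _ => ⟨?_, ?_⟩, (FormalIso.toJet_injective j hψ).injOn, ?_⟩
  · exact (pt_map_mem_autC_iff j _).2 ((jetIdeal_eq_top_iff ht _).2 (φ.isUnit_coeff_one_toHom hψ))
  · exact (Jet.base_pt_map_eq_iff j _ x).2 φ.constantCoeff_toHom
  · rintro y ⟨hy, hyx⟩
    obtain ⟨χ, rfl⟩ := Jet.exists_eq_map j y (by rw [hyx]; exact Pt.range_map_subset _ _)
    rw [pt_map_mem_autC_iff, jetIdeal_eq_top_iff ht] at hy
    obtain ⟨ρ, rfl⟩ := FormalIso.exists_toHom_act_eq ht hψ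
      ((Jet.base_pt_map_eq_iff j χ x).1 hyx) hy
    exact ⟨FormalIso.act ρ ψ, trivial, rfl⟩

theorem isTrivialization_of_isRho (j : Pt p A) [IsOpenImmersion j.1] {t : A}
    (ht : IsCoordinate k t)
    {rho : ∀ (R : Type u) [CommRing R] [Algebra k R] (x : A →ₐ[k] R), FormalIso x}
    (hrho : ∀ (R : Type u) [CommRing R] [Algebra k R] (x : A →ₐ[k] R), (rho R x).IsRho t) :
    IsTrivialization (fun R _ _ => AutC p R) j
      (fun R _ _ x ρ => (FormalIso.act ρ (rho R x)).toJet j) where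
  bijOn R _ _ x := by
    refine (bijOn_toJet j ht x).comp (f := fun ρ => FormalIso.act ρ (rho R x)) ?_
    refine ⟨Set.mapsTo_univ _ _, (rho R x).act_injective.injOn, fun φ _ => ?_⟩
    obtain ⟨ρ, hρ⟩ := φ.exists_act_eq (hrho R x)
    exact ⟨ρ, trivial, hρ⟩
  equivariant R _ _ x σ ρ := FormalIso.toJet_act j σ (FormalIso.act ρ (rho R x))
  natural R S _ _ _ _ f x ρ := by
    obtain ⟨d, hd⟩ := ht.exists_derivation j.isSmoothCurve
    rw [FormalIso.toJet_act, FormalIso.toJet_act, Jet.map_smul]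
    congr 1
    rw [FormalIso.toJet, FormalIso.toJet, Jet.map_pt_map, (hrho R x).toHom_eq_taylorAt ht hd,
      (hrho S _).toHom_eq_taylorAt ht hd]
    rfl

theorem existsUnique_smul_eq_of_range_subset (j : Pt p A) [IsOpenImmersion j.1] {t : A}
    (ht : IsCoordinate k t) {y y' : Jet p R} (hy : y ∈ AutC p R) (hy' : y' ∈ AutC p R)
    (h : y.base = y'.base) (hj : Set.range y.base.1 ⊆ Set.range j.1) :
    ∃! ρ : AutPlus R, ρ • y = y' := by
  obtain ⟨x, hx⟩ := Pt.exists_eq_map j y.base hj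
  obtain ⟨d, hd⟩ := ht.exists_derivation j.isSmoothCurve
  obtain ⟨ψ, hψ, -⟩ := FormalIso.existsUnique_isRho ht hd x
  obtain ⟨φ, -, rfl⟩ := (bijOn_toJet j ht x).surjOn ⟨hy, hx⟩
  obtain ⟨φ', -, rfl⟩ := (bijOn_toJet j ht x).surjOn ⟨hy', h.symm.trans hx⟩
  obtain ⟨ρ, rfl⟩ := φ.exists_act_eq hψ
  obtain ⟨ρ', rfl⟩ := φ'.exists_act_eq hψ
  refine ⟨ρ' * ρ⁻¹, ?_, fun σ hσ => ?_⟩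
  · simp only [FormalIso.toJet_act, mul_smul, inv_smul_smul]
  · rw [_root_.eq_mul_inv_iff_mul_eq]
    refine ψ.act_injective (FormalIso.toJet_injective j hψ ?_)
    exact (FormalIso.toJet_act j σ (FormalIso.act ρ ψ)).trans hσ

end AutC

/-! ### Gluing -/

section Gluing

theorem isUnit_of_forall_isUnit_away {R : Type*} [CommRing R] {s : Set R} (hs : Ideal.span s = ⊤)
    {r : R} (h : ∀ f ∈ s, IsUnit (algebraMap R (Localization.Away f) r)) : IsUnit r := by
  have span_le : Ideal.span s ≤ (Ideal.span {r}).radical := Ideal.span_le.2 fun f hf => by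
    obtain ⟨n, hn⟩ := (IsLocalization.Away.algebraMap_isUnit_iff f).1 (h f hf)
    exact ⟨n, Ideal.mem_span_singleton.2 hn⟩
  rw [← Ideal.span_singleton_eq_top, ← Ideal.radical_eq_top, ← top_le_iff, ← hs]
  exact span_le

namespace AutPlus

theorem ext_of_jointly_injective {R : Type u} [CommRing R] {ι : Type*} {S : ι → Type u}
    [∀ i, CommRing (S i)] (f : ∀ i, R →+* S i) (hf : ∀ r, (∀ i, f i r = 0) → r = 0)
    {ρ τ : AutPlus R} (h : ∀ i, map (f i) ρ = map (f i) τ) : ρ = τ := by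
  refine ext_X (PowerSeries.ext fun n => sub_eq_zero.1 (hf _ fun i => ?_))
  rw [map_sub, sub_eq_zero, ← coeff_map, ← coeff_map, ← map_apply_X, ← map_apply_X, h]

theorem exists_forall_map_eq {R : Type u} [CommRing R] {s : Set R} (hs : Ideal.span s = ⊤)
    (ρ : ∀ f : s, AutPlus (Localization.Away f.1))
    (hρ : ∀ (f g : s) (e₁ : Localization.Away f.1 →ₐ[R] Localization.Away (f.1 * g.1))
      (e₂ : Localization.Away g.1 →ₐ[R] Localization.Away (f.1 * g.1)),
      map e₁.toRingHom (ρ f) = map e₂.toRingHom (ρ g)) :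
    ∃ σ : AutPlus R, ∀ f : s, map (algebraMap R (Localization.Away f.1)) σ = ρ f := by
  have glue_coeff (n : ℕ) : ∃ r : R, ∀ f : s, algebraMap R _ r = coeff n ((ρ f).1 X) := by
    refine (Localization.existsUnique_algebraMap_eq_of_span_eq_top s hs
      (fun f => coeff n ((ρ f).1 X)) fun f g => ?_).exists
    have compatible := congrArg (fun τ => coeff n (τ.1 X)) <| hρ f g
      ⟨IsLocalization.Away.awayToAwayRight f.1 g.1, IsLocalization.Away.awayToAwayRight_eq f.1 g.1⟩
      ⟨IsLocalization.Away.awayToAwayLeft g.1 f.1, IsLocalization.Away.awayToAwayLeft_eq g.1 f.1⟩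
    simp only [map_apply_X, coeff_map] at compatible
    exact compatible
  choose r hr using glue_coeff
  have r_zero : r 0 = 0 :=
    Localization.algebraMap_injective_of_span_eq_top s hs <| funext fun f => by
      change algebraMap R _ (r 0) = algebraMap R _ 0
      rw [hr, coeff_zero_eq_constantCoeff_apply, constantCoeff_apply, constantCoeff_X, map_zero]
  have isUnit_r_one : IsUnit (r 1) := isUnit_of_forall_isUnit_away hs fun f hf => by
    rw [hr 1 ⟨f, hf⟩]
    exact isUnit_coeff_one _
  obtain ⟨σ, hσ⟩ := exists_apply_X (g := PowerSeries.mk r)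
    (by rwa [← coeff_zero_eq_constantCoeff_apply, coeff_mk]) (by rwa [coeff_mk])
  refine ⟨σ, fun f => ext_X (PowerSeries.ext fun n => ?_)⟩
  rw [map_apply_X, hσ, coeff_map, coeff_mk, hr]

end AutPlus

variable {k : Type u} [Field k] {C : Scheme.{u}} {p : C ⟶ Spec (CommRingCat.of k)}
  {R : Type u} [CommRing R] [Algebra k R]

theorem existsUnique_smul_eq_of_locally [IsSeparated p] {s : Set R} (hs : Ideal.span s = ⊤)
    {y y' : Jet p R} (h : ∀ f ∈ s, ∀ (S : Type u) [CommRing S] [Algebra k S] (g : R →ₐ[k] S),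
      IsUnit (g f) → ∃! ρ : AutPlus S, ρ • Jet.map g y = Jet.map g y') :
    ∃! ρ : AutPlus R, ρ • y = y' := by
  let π (f : R) : R →ₐ[k] Localization.Away f := IsScalarTower.toAlgHom k R (Localization.Away f)
  have π_injective (r : R) (hr : ∀ f : s, π f r = 0) : r = 0 :=
    Localization.algebraMap_injective_of_span_eq_top s hs <| funext fun f =>
      (hr f).trans (map_zero (π f)).symm
  choose ρ hρ ρ_unique using fun f : s =>
    h f f.2 _ (π f) (IsLocalization.Away.algebraMap_isUnit f.1)
  have map_smul_eq (f : s) {S : Type u} [CommRing S] [Algebra k S] [Algebra R S]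
      [IsScalarTower k R S] (e : Localization.Away f.1 →ₐ[R] S) :
      AutPlus.map e.toRingHom (ρ f) • Jet.map (IsScalarTower.toAlgHom k R S) y =
        Jet.map (IsScalarTower.toAlgHom k R S) y' := by
    have e_comp : (e.restrictScalars k).comp (π f) = IsScalarTower.toAlgHom k R S :=
      AlgHom.ext e.commutes
    rw [← e_comp, ← Jet.map_map, ← Jet.map_map, ← hρ]
    exact (Jet.map_smul (e.restrictScalars k) _ _).symm
  obtain ⟨σ, hσ⟩ := AutPlus.exists_forall_map_eq hs ρ fun f g e₁ e₂ =>
    (h f f.2 _ (IsScalarTower.toAlgHom k R (Localization.Away (f.1 * g.1)))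
      (isUnit_of_mul_isUnit_left (y := algebraMap R _ g.1) <| by
        rw [IsScalarTower.coe_toAlgHom', ← map_mul]
        exact IsLocalization.Away.algebraMap_isUnit _)).unique (map_smul_eq f e₁) (map_smul_eq g e₂)
  refine ⟨σ, Jet.ext_of_jointly_injective (fun f : s => π f) π_injective fun f => ?_,
    fun τ hτ => AutPlus.ext_of_jointly_injective (fun f : s => (π f).toRingHom) π_injective
      fun f => ?_⟩
  · rw [Jet.map_smul, ← hρ]
    exact congrArg (· • _) (hσ f)
  · refine (ρ_unique f _ ?_).trans (hσ f).symm
    rw [← hτ, Jet.map_smul]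

/-- The functions `f` on `Spec R` such that `x : Spec R ⟶ C` maps `D(f)` into an affine open of
`C` on which there is a coordinate. -/
def Pt.coordinateLocus (x : Pt p R) : Set R :=
  {f | ∃ (A : Type u) (_ : CommRing A) (_ : Algebra k A) (j : Pt p A) (t : A),
    IsOpenImmersion j.1 ∧ IsCoordinate k t ∧
      ∀ q : PrimeSpectrum R, f ∉ q.asIdeal → x.1 q ∈ Set.range j.1}

variable [SmoothOfRelativeDimension 1 p]

theorem Pt.span_coordinateLocus (x : Pt p R) : Ideal.span x.coordinateLocus = ⊤ := by
  by_contra hne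
  obtain ⟨m, hm, hle⟩ := Ideal.exists_le_maximal _ hne
  let q : PrimeSpectrum R := ⟨m, hm.isPrime⟩
  obtain ⟨A, _, _, j, _, hj, t, ht⟩ := exists_coordinate_chart p (x.1 q)
  obtain ⟨f, hf, apply_mem⟩ := x.exists_notMem_forall_apply_mem q j.1.opensRange hj
  exact hf (hle (Ideal.subset_span ⟨A, _, _, j, t, ‹_›, ht, apply_mem⟩))

theorem existsUnique_smul_eq [CharZero k] [IsSeparated p] {y y' : Jet p R} (hy : y ∈ AutC p R)
    (hy' : y' ∈ AutC p R) (h : y.base = y'.base) : ∃! ρ : AutPlus R, ρ • y = y' := by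
  refine existsUnique_smul_eq_of_locally (Pt.span_coordinateLocus y.base) ?_
  rintro f ⟨A, _, _, j, t, _, ht, apply_mem⟩ S _ _ g hg
  refine existsUnique_smul_eq_of_range_subset j ht (map_mem_autC g hy) (map_mem_autC g hy') ?_ ?_
  · rw [Jet.base_map, Jet.base_map, h]
  · rw [Jet.base_map]
    exact Pt.range_map_subset_of_isUnit y.base apply_mem g hg

end Gluing

/-! ### Trivializations and changes of coordinates -/

section Trivialization

variable {k : Type u} [Field k] {C : Scheme.{u}} {p : C ⟶ Spec (CommRingCat.of k)}
  {A : Type u} [CommRing A] [Algebra k A]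

theorem isLeftTorsor_autC [CharZero k] [IsSeparated p] [SmoothOfRelativeDimension 1 p] :
    IsLeftTorsor (p := p) (fun R _ _ => AutC p R) where
  map_mem _ _ _ _ _ _ f _ hy := map_mem_autC f hy
  smul_mem _ _ _ ρ _ hy := smul_mem_autC ρ hy
  map_smul _ _ _ _ _ _ f ρ y _ := Jet.map_smul f ρ y
  base_smul _ _ _ ρ y _ := Jet.base_smul ρ y
  simply_transitive _ _ _ _ _ hy hy' h := existsUnique_smul_eq hy hy' h
  locally_trivial c := by
    obtain ⟨A, _, _, j, _, hc, t, ht⟩ := exists_coordinate_chart p c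
    obtain ⟨d, hd⟩ := ht.exists_derivation j.isSmoothCurve
    choose rho hrho using fun (R : Type u) [CommRing R] [Algebra k R] (x : A →ₐ[k] R) =>
      (FormalIso.existsUnique_isRho ht hd x).exists
    exact ⟨A, _, _, j, ‹_›, hc, _, isTrivialization_of_isRho j ht hrho⟩

theorem IsCoordinate.exists_autPlus_apply_X_eq {t s : A} (hs : IsCoordinate k s)
    {d : Derivation k A A} (hd : d t = 1) :
    ∃ u : AutPlus A, u.1 X = PowerSeries.mk
      (fun n => if n = 0 then 0 else algebraMap k A (n.factorial : k)⁻¹ * d^[n] s) := by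
  refine AutPlus.exists_apply_X ?_ ?_
  · rw [← coeff_zero_eq_constantCoeff_apply, coeff_mk, if_pos rfl]
  · simpa [coeff_mk] using hs.isUnit_derivation hd

theorem FormalIso.IsRho.toJet_act_eq [CharZero k] (j : Pt p A) {t s : A} (ht : IsCoordinate k t)
    (hs : IsCoordinate k s) {d : Derivation k A A} (hd : d t = 1) {u : AutPlus A}
    (hu : PowerSeries.C s + u.1 X = taylorSeries d s) {R : Type u} [CommRing R] [Algebra k R]
    {x : A →ₐ[k] R} {φ φ' : FormalIso x} (hφ : φ.IsRho t) (hφ' : φ'.IsRho s) (ρ : AutPlus R) :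
    (act ρ φ).toJet j = (act (ρ * AutPlus.map x.toRingHom u) φ').toJet j := by
  rw [toJet_act, toJet_act, mul_smul, ← toJet_act j _ φ', toJet, toJet,
    hφ.toHom_eq_act ht hs hd hu hφ']

end Trivialization

end CurveJets

end

theorem mainTheorem2_general {k : Type u} [Field k] [CharZero k]
    (C : Scheme.{u}) (p : C ⟶ Spec (CommRingCat.of k))
    [IsSeparated p] [SmoothOfRelativeDimension 1 p] :
    IsLeftTorsor (p := p) (fun R _ _ => AutC p R) ∧
    ∀ (A : Type u) [CommRing A] [Algebra k A] (j : Pt p A) [IsOpenImmersion j.1],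
      (∀ t : A, IsCoordinate k t →
        (∀ (R : Type u) [CommRing R] [Algebra k R] (x : A →ₐ[k] R),
          Set.BijOn (fun φ : FormalIso x => φ.toJet j) Set.univ
            {y | y ∈ AutC p R ∧ y.base = Pt.map x j}) ∧
        (∀ (R : Type u) [CommRing R] [Algebra k R] (x : A →ₐ[k] R),
          ∃! φ : FormalIso x, φ.IsRho t) ∧
        ∀ rho : ∀ (R : Type u) [CommRing R] [Algebra k R] (x : A →ₐ[k] R), FormalIso x,
          (∀ (R : Type u) [CommRing R] [Algebra k R] (x : A →ₐ[k] R), (rho R x).IsRho t) →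
          IsTrivialization (fun R _ _ => AutC p R) j
            (fun R _ _ x ρ => (FormalIso.act ρ (rho R x)).toJet j)) ∧
      ∀ t s : A, IsCoordinate k t → IsCoordinate k s →
        ∃ d : Derivation k A A, d t = 1 ∧
          ∃ u : AutPlus A,
            u.1 X = PowerSeries.mk
              (fun n => if n = 0 then 0 else algebraMap k A (n.factorial : k)⁻¹ * d^[n] s) ∧
            ∀ (R : Type u) [CommRing R] [Algebra k R] (x : A →ₐ[k] R) (φ φ' : FormalIso x),
              φ.IsRho t → φ'.IsRho s → ∀ ρ : AutPlus R,
                (FormalIso.act ρ φ).toJet j =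
                  (FormalIso.act (ρ * AutPlus.map x.toRingHom u) φ').toJet j := by
  refine ⟨isLeftTorsor_autC, fun A _ _ j _ => ⟨fun t ht => ?_, fun t s ht hs => ?_⟩⟩
  · obtain ⟨d, hd⟩ := ht.exists_derivation j.isSmoothCurve
    exact ⟨fun R _ _ x => bijOn_toJet j ht x, fun R _ _ x => FormalIso.existsUnique_isRho ht hd x,
      fun rho hrho => isTrivialization_of_isRho j ht hrho⟩
  · obtain ⟨d, hd⟩ := ht.exists_derivation j.isSmoothCurve
    obtain ⟨u, hu⟩ := hs.exists_autPlus_apply_X_eq hd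
    have taylor_eq : PowerSeries.C s + u.1 X = taylorSeries d s := by
      rw [hu, C_add_mk_eq_taylorSeries]
    exact ⟨d, hd, u, hu, fun R _ _ x φ φ' hφ hφ' ρ => hφ.toJet_act_eq j ht hs hd taylor_eq hφ' ρ⟩

theorem mainTheorem2 {k : Type u} [Field k] [IsAlgClosed k] [CharZero k]
    (C : Scheme.{u}) (p : C ⟶ Spec (CommRingCat.of k))
    [IsSeparated p] [SmoothOfRelativeDimension 1 p] :
    -- `Aut_C → C` is a left `Aut⁺O`-torsor
    IsLeftTorsor (p := p) (fun R _ _ => AutC p R) ∧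
    -- `j : Spec A ⟶ C` is an affine open `U` of `C` (all of `C` if `j` is an isomorphism)
    ∀ (A : Type u) [CommRing A] [Algebra k A] (j : Pt p A) [IsOpenImmersion j.1],
      (∀ t : A, IsCoordinate k t →
        -- for `x ∈ U(R)`, the elements of `Aut_C(R)` over `x` are the pairs `(x, φ)`
        (∀ (R : Type u) [CommRing R] [Algebra k R] (x : A →ₐ[k] R),
          Set.BijOn (fun φ : FormalIso x => φ.toJet j) Set.univ
            {y | y ∈ AutC p R ∧ y.base = Pt.map x j}) ∧
        -- the isomorphisms `ρ^x_t` exist and are unique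
        (∀ (R : Type u) [CommRing R] [Algebra k R] (x : A →ₐ[k] R),
          ∃! φ : FormalIso x, φ.IsRho t) ∧
        -- `ψ_t : (x, ρ) ↦ (x, ρ ρ^x_t)` is a trivialization over `U`
        ∀ rho : ∀ (R : Type u) [CommRing R] [Algebra k R] (x : A →ₐ[k] R), FormalIso x,
          (∀ (R : Type u) [CommRing R] [Algebra k R] (x : A →ₐ[k] R), (rho R x).IsRho t) →
          IsTrivialization (fun R _ _ => AutC p R) j
            (fun R _ _ x ρ => (FormalIso.act ρ (rho R x)).toJet j)) ∧
      -- change of coordinates: `ψ_s⁻¹ ψ_t (x, ρ) = (x, ρ · x(u))` for the element `u` of `Aut⁺O(A)`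
      -- with `u(z) = ∑_{n ≥ 1} (1/n!) ∂_tⁿ(s) zⁿ`
      ∀ t s : A, IsCoordinate k t → IsCoordinate k s →
        ∃ d : Derivation k A A, d t = 1 ∧
          ∃ u : AutPlus A,
            u.1 X = PowerSeries.mk
              (fun n => if n = 0 then 0 else algebraMap k A (n.factorial : k)⁻¹ * d^[n] s) ∧
            ∀ (R : Type u) [CommRing R] [Algebra k R] (x : A →ₐ[k] R) (φ φ' : FormalIso x),
              φ.IsRho t → φ'.IsRho s → ∀ ρ : AutPlus R,
                (FormalIso.act ρ φ).toJet j = (FormalIso.act (ρ * AutPlus.map x.toRingHom u) φ').toJet j :=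
  mainTheorem2_general C p
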